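/- Let $d\ge 2$, $n_1,\dots,n_d\ge 2$, $n=n_1+\cdots+n_d$, and write $x=(x_1,\dots,x_d)$, $\xi=(\xi_1,\dots,\xi_d)\in\mathbb R^{n}=\mathbb R^{n_1}\times\cdots\times\mathbb R^{n_d}$. Let $\mathbf S^m(\mathbb R^{\vec n})$ denote the class of all $\sigma\in C^\infty(\mathbb R^n\times\mathbb R^n)$ such that for all multi-indices $\alpha=(\alpha_1,\dots,\alpha_d)$, $\beta$ (with $\alpha_i$ a multi-index in the variable $\xi_i$) there is a constant $C_{\alpha,\beta}$ with $$\left|\partial_\xi^\alpha\partial_x^\beta\sigma(x,\xi)\right|\le C_{\alpha,\beta}(1+|\xi|)^m\prod_{i=1}^d(1+|\xi_i|)^{-|\alpha_i|}\qquad\text{for all }x,\xi\in\mathbb R^n.$$ The order $-(n-d)|1/p-1/2|$ for $L^p$-boundedness of Fourier integral operators with symbols in this class and phases of the form $\sum_i\Phi_i(x_i,\xi_i)$ is optimal, in the following sense. For every real $m$ with $-(n-d)/2<m\le 0$ there is a symbol $\sigma\in\mathbf S^m(\mathbb R^{\vec n})$ with compact support in $x$ such that the operator $$Tf(x)=\int_{\mathbb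 R^n}e^{2\pi i\sum_{i=1}^d\Phi_i(x_i,\xi_i)}\,\sigma(x,\xi)\,\widehat f(\xi)\,d\xi,\qquad \Phi_i(x_i,\xi_i)=x_i\cdot\xi_i+|\xi_i|,\qquad \widehat f(\xi)=\int_{\mathbb R^n} e^{-2\pi i x\cdot\xi}f(x)\,dx,$$ defined for Schwartz functions $f$, is not bounded on $L^p(\mathbb R^n)$ for any $1<p<\infty$ with $m>-(n-d)\left|\frac1p-\frac12\right|$; that is, for every such $p$ there is no constant $C$ with $\|Tf\|_{L^p(\mathbb R^n)}\le C\|f\|_{L^p(\mathbb R^n)}$ for all Schwartz functions $f$. -/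

import Mathlib

open MeasureTheory
open scoped ContDiff FourierTransform SchwartzMap ENNReal NNReal

noncomputable section

/-- The product space `ℝ^{n₁} × ⋯ × ℝ^{n_d}` with its Euclidean norm, i.e. `ℝⁿ` with
`n = n₁ + ⋯ + n_d`, whose points are written `x = (x₁, …, x_d)` with `x i ∈ ℝ^{n_i}`. -/
abbrev MultiSpace {d : ℕ} (n : Fin d → ℕ) : Type :=
  PiLp 2 (fun i : Fin d => EuclideanSpace ℝ (Fin (n i)))

/-- The standard unit vector of `ℝ^{n₁} × ⋯ × ℝ^{n_d}` in the `j.2`-th coordinate of the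
block `j.1`. -/
def unitVec {d : ℕ} (n : Fin d → ℕ) (j : Σ i : Fin d, Fin (n i)) : MultiSpace n :=
  WithLp.toLp 2 (Pi.single j.1 (EuclideanSpace.single j.2 (1 : ℝ)))

/-- The mixed partial derivative
`∂_{ξ_{J 0}} ⋯ ∂_{ξ_{J (r-1)}} ∂_{x_{K 0}} ⋯ ∂_{x_{K (s-1)}} σ (x, ξ)`.
The tuples `J` and `K` of coordinates encode the multi-indices: `J` corresponds to the multi-index
`α` whose entry at a coordinate is the number of times `J` takes that coordinate as its value,
and likewise `K` corresponds to `β`. -/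
def symbolPartial {d : ℕ} {n : Fin d → ℕ} (σ : MultiSpace n → MultiSpace n → ℂ)
    {r s : ℕ} (J : Fin r → Σ i : Fin d, Fin (n i)) (K : Fin s → Σ i : Fin d, Fin (n i))
    (x ξ : MultiSpace n) : ℂ :=
  iteratedFDeriv ℝ r
    (fun ξ' => iteratedFDeriv ℝ s (fun x' => σ x' ξ') x (fun b => unitVec n (K b)))
    ξ (fun a => unitVec n (J a))

/-- `|α_i|`: the number of the differentiations listed in `J` that fall on the `i`-th block. -/
def blockOrder {d : ℕ} {n : Fin d → ℕ} {r : ℕ} (J : Fin r → Σ i : Fin d, Fin (n i))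
    (i : Fin d) : ℕ :=
  (Finset.univ.filter (fun a => (J a).1 = i)).card

/-- The product Hörmander class `S^m(ℝ^{n₁} × ⋯ × ℝ^{n_d})`: smooth `σ` with
`|∂_ξ^α ∂_x^β σ(x, ξ)| ≤ C_{α,β} (1 + |ξ|)^m ∏_i (1 + |ξ_i|)^{-|α_i|}`
for all multi-indices `α`, `β`. -/
structure IsProductSymbol {d : ℕ} {n : Fin d → ℕ} (m : ℝ)
    (σ : MultiSpace n → MultiSpace n → ℂ) : Prop where
  smooth : ContDiff ℝ ∞ (fun z : MultiSpace n × MultiSpace n => σ z.1 z.2)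
  bound : ∀ (r s : ℕ) (J : Fin r → Σ i : Fin d, Fin (n i)) (K : Fin s → Σ i : Fin d, Fin (n i)),
    ∃ C : ℝ, ∀ x ξ : MultiSpace n,
      ‖symbolPartial σ J K x ξ‖ ≤
        C * (1 + ‖ξ‖) ^ m * ∏ i, ((1 + ‖ξ i‖) ^ blockOrder J i)⁻¹

/-- `σ` has compact support in `x`: `σ(x, ξ) = 0` for all `ξ` and all `x` outside some compact
set. -/
def HasCompactSupportInX {d : ℕ} {n : Fin d → ℕ} (σ : MultiSpace n → MultiSpace n → ℂ) : Prop :=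
  ∃ K : Set (MultiSpace n), IsCompact K ∧ ∀ x ∉ K, ∀ ξ, σ x ξ = 0

/-- The phase `Φ_i(x_i, ξ_i) = x_i · ξ_i + |ξ_i|` on `ℝ^k × ℝ^k`. -/
def wavePhase {k : ℕ} (x ξ : EuclideanSpace ℝ (Fin k)) : ℝ :=
  inner ℝ x ξ + ‖ξ‖

/-- The phase `Φ(x, ξ) = ∑_i Φ_i(x_i, ξ_i)`. -/
def sumPhase {d : ℕ} {n : Fin d → ℕ}
    (φ : ∀ i, EuclideanSpace ℝ (Fin (n i)) → EuclideanSpace ℝ (Fin (n i)) → ℝ)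
    (x ξ : MultiSpace n) : ℝ :=
  ∑ i, φ i (x i) (ξ i)

/-- The Fourier integral operator `T f(x) = ∫ e^{2π i Φ(x, ξ)} σ(x, ξ) f̂(ξ) dξ` on Schwartz
functions, where `f̂(ξ) = ∫ e^{-2π i x · ξ} f(x) dx`. -/
def fourierIntegralOp {d : ℕ} {n : Fin d → ℕ} (Φ : MultiSpace n → MultiSpace n → ℝ)
    (σ : MultiSpace n → MultiSpace n → ℂ) (f : 𝓢(MultiSpace n, ℂ)) (x : MultiSpace n) : ℂ :=
  ∫ ξ, Complex.exp (2 * Real.pi * Complex.I * (Φ x ξ : ℂ)) * σ x ξ *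
    𝓕 (f : MultiSpace n → ℂ) ξ

/-- `T`, given on Schwartz functions, is bounded on `L^p`: there is `C` with
`‖T f‖_{L^p} ≤ C ‖f‖_{L^p}` for all Schwartz `f`. -/
def IsBoundedOnLp {d : ℕ} {n : Fin d → ℕ} (p : ℝ≥0∞)
    (T : 𝓢(MultiSpace n, ℂ) → MultiSpace n → ℂ) : Prop :=
  ∃ C : ℝ≥0, ∀ f : 𝓢(MultiSpace n, ℂ), eLpNorm (T f) p volume ≤ C * eLpNorm f p volume

end

/-!
The symbol is `σ(x, ξ) = a(x) b(ξ)`, with `a` a cutoff equal to `1` on a large ball and `b` smooth,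
equal to `|ξ|^m` for `|ξ| ≥ 1`. Write `N = ∑ n_i` and `S(ξ) = ∑ |ξ_i|`; then `T` is `a` times the
Fourier multiplier `e^{2π i S} b`. Fix a bump `χ` supported where all `|ξ_i| ≥ 1`. The operator is
tested on functions of frequency `l → ∞`, obtained from the half-waves `g` with
`ĝ(ξ) = e^{± 2π i S(ξ)} χ(ξ / l)`.

The half-waves have `‖g‖_2 ~ l^{N / 2}` and `‖g‖_∞ ≲ l^{(N + d) / 2}`
(`IsBlockBump.exists_norm_fourierInv_halfWave_le`). The second bound is the heart of the matter.
Absorbing the factor `e^{2π S(ξ / l)}` into the bump, it is a bound on the Fourier transform of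
`e^{-2π z S(ξ)}` for the complex number `z = 1 / l ∓ i`, which factors over the blocks. On `ℝ^k`,
completing the square gives the subordination formula (`integral_subordination`)
`e^{-2π z r} = 2 z^{1/2} ∫_0^∞ e^{-π z (v² + r² / v²)} dv`, valid for all `z` with `Re z > 0`, and
the Fourier transforms of the complex Gaussians in the integrand are explicit. The triangle
inequality then yields `C (Re z)^{-(k + 1) / 2}` (`exists_norm_fourier_exp_neg_norm_le`), with
neither stationary phase nor decay estimates for spherical measures.

For `p > 2`, take the half-wave `f` with the minus sign: interpolation between `L^2` and `L^∞`
bounds `‖f‖_p` from above, while `T f` is, up to the factor `a`, a bump of height `l^{m + N}` on the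
scale `1 / l`. For `p < 2`, take for `f` a bump on the scale `1 / l`, so chosen that `T f` is
`l^m a g` with `g` the half-wave with the plus sign. Its `L^p` norm is bounded from below by
interpolating `L^2` between `L^p` and `L^∞`. This needs that `a g` keeps a fixed proportion of the
`L^2` norm of `g`, which follows from Chebyshev's inequality and a second moment estimate
(`IsBlockBump.exists_le_integral_cutoff_halfWave`). In both cases the ratio of the norms is at least
a multiple of `l^{m + (N - d) |1 / p - 1 / 2|}`. For `p = 2` there is nothing to prove, as `m ≤ 0`.
-/

/-! ### Subordination of exponentials to Gaussians -/

open Set in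
/-- The map `v ↦ v - r / v` is a bijection from `(0, ∞)` to the real line. -/
theorem sub_div_bijOn {r : ℝ} (hr : 0 < r) :
    InjOn (fun v : ℝ => v - r / v) (Ioi 0) ∧ (fun v : ℝ => v - r / v) '' (Ioi 0) = univ := by
  constructor
  · intro a (ha : 0 < a) b (hb : 0 < b) h
    have h' : (a - b) * (a * b + r) = 0 := by
      simp only at h
      field_simp at h
      linear_combination h
    rcases mul_eq_zero.1 h' with h0 | h0
    · linarith
    · have : 0 < a * b := mul_pos ha hb
      linarith
  · refine eq_univ_of_forall fun w => ?_
    have hs : 0 ≤ w ^ 2 + 4 * r := by positivity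
    have h1 : |w| < √(w ^ 2 + 4 * r) := by
      rw [← Real.sqrt_sq_eq_abs]
      exact Real.sqrt_lt_sqrt (sq_nonneg _) (by linarith)
    have h2 : 0 < w + √(w ^ 2 + 4 * r) := by linarith [neg_abs_le w]
    refine ⟨(w + √(w ^ 2 + 4 * r)) / 2, by simpa using h2, ?_⟩
    have := Real.sq_sqrt hs
    simp only
    field_simp
    nlinarith

open Set in
/-- Completing the square turns the integral into a Gaussian one: with `w = v - r / v`, the
Gaussian integral over the line splits into two integrals over `(0, ∞)`, which are exchanged by
`v ↦ r / v`. -/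
theorem integral_gaussian_sub_div {b : ℂ} (hb : 0 < b.re) {r : ℝ} (hr : 0 < r) :
    IntegrableOn (fun v : ℝ => Complex.exp (-b * ((v - r / v : ℝ) : ℂ) ^ 2)) (Ioi 0) ∧
    ∫ v in Ioi (0 : ℝ), Complex.exp (-b * ((v - r / v : ℝ) : ℂ) ^ 2) =
      (Real.pi / b) ^ (1 / 2 : ℂ) / 2 := by
  set G : ℝ → ℂ := fun w => Complex.exp (-b * (w : ℂ) ^ 2) with hG
  obtain ⟨hinj, himg⟩ := sub_div_bijOn hr
  have hder : ∀ v ∈ Ioi (0 : ℝ),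
      HasDerivWithinAt (fun v : ℝ => v - r / v) (1 + r / v ^ 2) (Ioi 0) v := by
    intro v (hv : 0 < v)
    have := (hasDerivAt_id v).sub ((hasDerivAt_inv hv.ne').const_mul r)
    refine (this.congr_deriv ?_).hasDerivWithinAt
    field_simp
    ring
  have habs : ∀ v ∈ Ioi (0 : ℝ), |1 + r / v ^ 2| = 1 + r / v ^ 2 := by
    intro v _
    exact abs_of_pos (by positivity)
  have hGint : Integrable G := integrable_cexp_neg_mul_sq hb
  have hI : IntegrableOn (fun v : ℝ => |1 + r / v ^ 2| • G (v - r / v)) (Ioi 0) := by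
    rw [← integrableOn_image_iff_integrableOn_abs_deriv_smul measurableSet_Ioi hder hinj, himg]
    exact hGint.integrableOn
  have hmeas : Measurable (fun v : ℝ => G (v - r / v)) := by
    simp only [hG]
    fun_prop
  have hI1 : IntegrableOn (fun v : ℝ => G (v - r / v)) (Ioi 0) := by
    refine Integrable.mono hI hmeas.aestronglyMeasurable ?_
    refine (ae_restrict_mem measurableSet_Ioi).mono fun v hv => ?_
    rw [norm_smul, norm_abs_eq_norm, Real.norm_eq_abs, habs v hv]
    refine le_mul_of_one_le_left (norm_nonneg _) ?_
    have : 0 ≤ r / v ^ 2 := by positivity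
    linarith
  refine ⟨hI1, ?_⟩
  have hI2 : IntegrableOn (fun v : ℝ => (r / v ^ 2) • G (v - r / v)) (Ioi 0) := by
    refine (hI.sub hI1).congr ?_
    refine (ae_restrict_mem measurableSet_Ioi).mono fun v hv => ?_
    simp only [Pi.sub_apply, habs v hv, add_smul, one_smul, add_sub_cancel_left]
  have hsum : ∫ w, G w = (∫ v in Ioi (0 : ℝ), G (v - r / v)) +
      ∫ v in Ioi (0 : ℝ), (r / v ^ 2) • G (v - r / v) := by
    have h := integral_image_eq_integral_abs_deriv_smul measurableSet_Ioi hder hinj G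
    rw [himg, Measure.restrict_univ] at h
    rw [h, ← integral_add hI1 hI2]
    refine setIntegral_congr_fun measurableSet_Ioi fun v hv => ?_
    simp only [habs v hv, add_smul, one_smul]
  have hflip : ∫ v in Ioi (0 : ℝ), G (v - r / v) =
      ∫ v in Ioi (0 : ℝ), (r / v ^ 2) • G (v - r / v) := by
    have hder' : ∀ v ∈ Ioi (0 : ℝ),
        HasDerivWithinAt (fun v : ℝ => r / v) (-(r / v ^ 2)) (Ioi 0) v := by
      intro v (hv : 0 < v)
      have := (hasDerivAt_inv hv.ne').const_mul r
      refine (this.congr_deriv ?_).hasDerivWithinAt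
      field_simp
    have hinj' : InjOn (fun v : ℝ => r / v) (Ioi 0) := by
      intro a (ha : 0 < a) c (hc : 0 < c) h
      simp only at h
      field_simp at h
      exact h.symm
    have himg' : (fun v : ℝ => r / v) '' Ioi 0 = Ioi 0 := by
      ext w
      constructor
      · rintro ⟨v, hv, rfl⟩
        exact div_pos hr hv
      · intro (hw : 0 < w)
        exact ⟨r / w, div_pos hr hw, by field_simp⟩
    have h := integral_image_eq_integral_abs_deriv_smul measurableSet_Ioi hder' hinj'
      (fun v => G (v - r / v))
    rw [himg'] at h
    rw [h]
    refine setIntegral_congr_fun measurableSet_Ioi fun v (hv : 0 < v) => ?_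
    have e1 : |-(r / v ^ 2)| = r / v ^ 2 := by
      rw [abs_neg, abs_of_pos (by positivity)]
    have e2 : r / v - r / (r / v) = -(v - r / v) := by
      field_simp
      ring
    simp only [e1, e2, hG, Complex.ofReal_neg, neg_sq]
  have htot : ∫ w, G w = (Real.pi / b) ^ (1 / 2 : ℂ) := integral_gaussian_complex hb
  rw [← hflip, htot] at hsum
  change ∫ v in Ioi (0 : ℝ), G (v - r / v) = _
  rw [hsum]
  ring

open Set in
/-- Subordination: `e^{-2π z r}` is a superposition over `v > 0` of the Gaussians
`e^{-π z r² / v²}`, for every complex `z` with positive real part. -/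
theorem integral_subordination {z : ℂ} (hz : 0 < z.re) {r : ℝ} (hr : 0 ≤ r) :
    ∫ v in Ioi (0 : ℝ), Complex.exp (-(Real.pi * z) * ((v ^ 2 + r ^ 2 / v ^ 2 : ℝ) : ℂ)) =
      Complex.exp (-(2 * Real.pi * z * r)) * ((1 / z) ^ (1 / 2 : ℂ) / 2) := by
  have hb : 0 < (Real.pi * z).re := by
    rw [Complex.re_ofReal_mul]
    positivity
  have hpi : (Real.pi : ℂ) / (Real.pi * z) = 1 / z := by
    have : (Real.pi : ℂ) ≠ 0 := by exact_mod_cast Real.pi_ne_zero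
    have : z ≠ 0 := by
      rintro rfl
      simp at hz
    field_simp
  rcases hr.eq_or_lt with rfl | hr
  · have := integral_gaussian_complex_Ioi hb
    rw [hpi] at this
    simpa using this
  · have h := (integral_gaussian_sub_div hb hr).2
    rw [hpi] at h
    rw [← h, ← integral_const_mul]
    refine setIntegral_congr_fun measurableSet_Ioi fun v (hv : 0 < v) => ?_
    rw [← Complex.exp_add]
    congr 1
    have : (v : ℂ) ≠ 0 := by exact_mod_cast hv.ne'
    push_cast
    field_simp
    ring

/-! ### Fourier transforms of complex exponentials of the norm -/

section HalfWave

variable {E : Type*} [NormedAddCommGroup E] [InnerProductSpace ℝ E] [FiniteDimensional ℝ E]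
  [MeasurableSpace E] [BorelSpace E]

open Set in
/-- The value of the absolute moment of a Gaussian, with its homogeneity in the parameter. -/
theorem integral_pow_mul_gaussian {ε : ℝ} (hε : 0 < ε) (k : ℕ) :
    IntegrableOn (fun v : ℝ => v ^ k * Real.exp (-(Real.pi * ε) * v ^ 2)) (Ioi 0) ∧
    ∫ v in Ioi (0 : ℝ), v ^ k * Real.exp (-(Real.pi * ε) * v ^ 2) =
      ε ^ (-((k : ℝ) + 1) / 2) *
        (Real.pi ^ (-((k : ℝ) + 1) / 2) * (1 / 2) * Real.Gamma (((k : ℝ) + 1) / 2)) := by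
  have hb : 0 < Real.pi * ε := by positivity
  constructor
  · have := (integrable_rpow_mul_exp_neg_mul_sq hb (s := (k : ℝ))
      (by linarith [Nat.cast_nonneg (α := ℝ) k])).integrableOn (s := Ioi 0)
    simpa using this
  · have := integral_rpow_mul_exp_neg_mul_rpow (p := 2) (q := k) (b := Real.pi * ε) (by norm_num)
      (by linarith [Nat.cast_nonneg (α := ℝ) k]) hb
    simp only [Real.rpow_natCast, Real.rpow_ofNat] at this
    rw [this, Real.mul_rpow Real.pi_pos.le hε.le]
    ring

theorem sq_rpow_natCast_half {v : ℝ} (hv : 0 ≤ v) (k : ℕ) : (v ^ 2) ^ (k / 2 : ℝ) = v ^ k := by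
  rw [← Real.rpow_natCast v 2, ← Real.rpow_mul hv, ← Real.rpow_natCast v k]
  congr 1
  push_cast
  ring

theorem subordination_exponent (z : ℂ) (v r : ℝ) :
    Complex.exp (-(Real.pi * z) * ((v ^ 2 + r ^ 2 / v ^ 2 : ℝ) : ℂ)) =
      Complex.exp (-(Real.pi * z) * ((v ^ 2 : ℝ) : ℂ)) *
        Complex.exp (-(Real.pi * z / ((v ^ 2 : ℝ) : ℂ)) * (r : ℂ) ^ 2) := by
  rw [← Complex.exp_add]
  congr 1
  push_cast
  ring

theorem norm_cexp_neg_pi_mul (z : ℂ) (t : ℝ) :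
    ‖Complex.exp (-(Real.pi * z) * (t : ℂ))‖ = Real.exp (-(Real.pi * z.re) * t) := by
  rw [Complex.norm_exp]
  simp

open Set in
theorem integrable_subordination {z : ℂ} (hz : 0 < z.re) :
    Integrable (fun q : E × ℝ => Complex.exp (-(Real.pi * z) *
      ((q.2 ^ 2 + ‖q.1‖ ^ 2 / q.2 ^ 2 : ℝ) : ℂ)))
      ((volume : Measure E).prod (volume.restrict (Ioi (0 : ℝ)))) := by
  have hmeas : Measurable (fun q : E × ℝ => Complex.exp (-(Real.pi * z) *
      ((q.2 ^ 2 + ‖q.1‖ ^ 2 / q.2 ^ 2 : ℝ) : ℂ))) := by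
    fun_prop
  rw [integrable_prod_iff' hmeas.aestronglyMeasurable]
  have hb : ∀ v : ℝ, 0 < v → 0 < Real.pi * z.re / v ^ 2 := fun v hv => by positivity
  constructor
  · refine (ae_restrict_mem measurableSet_Ioi).mono fun v (hv : 0 < v) => ?_
    simp only [subordination_exponent]
    refine Integrable.const_mul ?_ _
    have hb' : 0 < (Real.pi * z / ((v ^ 2 : ℝ) : ℂ)).re := by
      rw [Complex.div_ofReal_re, Complex.re_ofReal_mul]
      exact hb v hv
    simpa using GaussianFourier.integrable_cexp_neg_mul_sq_norm_add hb' 0 (0 : E)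
  · have hval : ∀ v ∈ Ioi (0 : ℝ),
        (z.re ^ (-(Module.finrank ℝ E / 2 : ℝ))) *
          (v ^ Module.finrank ℝ E * Real.exp (-(Real.pi * z.re) * v ^ 2)) =
        ∫ ξ : E, ‖Complex.exp (-(Real.pi * z) * ((v ^ 2 + ‖ξ‖ ^ 2 / v ^ 2 : ℝ) : ℂ))‖ := by
      intro v (hv : 0 < v)
      simp only [norm_cexp_neg_pi_mul]
      have : ∀ ξ : E, Real.exp (-(Real.pi * z.re) * (v ^ 2 + ‖ξ‖ ^ 2 / v ^ 2)) =
          Real.exp (-(Real.pi * z.re) * v ^ 2) *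
            Real.exp (-(Real.pi * z.re / v ^ 2) * ‖ξ‖ ^ 2) := by
        intro ξ
        rw [← Real.exp_add]
        congr 1
        ring
      simp only [this]
      rw [integral_const_mul, GaussianFourier.integral_rexp_neg_mul_sq_norm (hb v hv)]
      have h1 : Real.pi / (Real.pi * z.re / v ^ 2) = v ^ 2 / z.re := by
        have := Real.pi_ne_zero
        field_simp
      rw [h1, Real.div_rpow (by positivity) hz.le, Real.rpow_neg hz.le, sq_rpow_natCast_half hv.le]
      ring
    exact ((integral_pow_mul_gaussian hz _).1.const_mul _).congr
      ((ae_restrict_mem measurableSet_Ioi).mono hval)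

theorem integrable_exp_neg_norm {z : ℂ} (hz : 0 < z.re) :
    Integrable (fun ξ : E => Complex.exp (-(2 * Real.pi * z * ‖ξ‖))) := by
  have hz0 : z ≠ 0 := by
    rintro rfl
    simp at hz
  have h := (integrable_subordination (E := E) hz).integral_prod_left
  simp only [integral_subordination hz (norm_nonneg _)] at h
  have hc : (1 / z) ^ (1 / 2 : ℂ) / 2 ≠ 0 := by
    simp [Complex.cpow_eq_zero_iff, hz0]
  exact (h.mul_const ((1 / z) ^ (1 / 2 : ℂ) / 2)⁻¹).congr
    (Filter.Eventually.of_forall fun ξ => mul_inv_cancel_right₀ hc _)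

/-- A Gaussian with complex parameter `π z / v²` has a Fourier transform of size
`(v² / |z|)^{k / 2}` with `k = dim E`. -/
theorem norm_fourier_gaussian_le {z : ℂ} (hz : 0 < z.re) {v : ℝ} (hv : 0 < v) (x : E) :
    ‖∫ ξ : E, Complex.exp (-(Real.pi * z / ((v ^ 2 : ℝ) : ℂ)) * (‖ξ‖ : ℂ) ^ 2 +
      2 * Real.pi * Complex.I * (inner ℝ x ξ : ℝ))‖ ≤
      v ^ Module.finrank ℝ E * ‖z‖ ^ (-(Module.finrank ℝ E / 2 : ℝ)) := by
  have hb' : 0 < (Real.pi * z / ((v ^ 2 : ℝ) : ℂ)).re := by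
    rw [Complex.div_ofReal_re, Complex.re_ofReal_mul]
    positivity
  rw [GaussianFourier.integral_cexp_neg_mul_sq_norm_add hb' (2 * Real.pi * Complex.I) x, norm_mul]
  set b : ℂ := Real.pi * z / ((v ^ 2 : ℝ) : ℂ) with hb
  have h1 : ‖Complex.exp ((2 * Real.pi * Complex.I) ^ 2 * (‖x‖ : ℂ) ^ 2 / (4 * b))‖ ≤ 1 := by
    rw [Complex.norm_exp, Real.exp_le_one_iff]
    have : (2 * Real.pi * Complex.I) ^ 2 * (‖x‖ : ℂ) ^ 2 / (4 * b) =
        ((-(Real.pi ^ 2 * ‖x‖ ^ 2) : ℝ) : ℂ) * b⁻¹ := by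
      rw [mul_pow, Complex.I_sq]
      push_cast
      ring
    rw [this, Complex.re_ofReal_mul, Complex.inv_re]
    have : 0 ≤ b.re / Complex.normSq b := div_nonneg hb'.le (Complex.normSq_nonneg _)
    nlinarith [mul_nonneg (by positivity : 0 ≤ Real.pi ^ 2 * ‖x‖ ^ 2) this]
  have h2 : ‖(Real.pi / b) ^ (Module.finrank ℝ E / 2 : ℂ)‖ =
      v ^ Module.finrank ℝ E * ‖z‖ ^ (-(Module.finrank ℝ E / 2 : ℝ)) := by
    have e1 : (Module.finrank ℝ E / 2 : ℂ) = ((Module.finrank ℝ E / 2 : ℝ) : ℂ) := by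
      push_cast
      rfl
    have e2 : ‖Real.pi / b‖ = v ^ 2 / ‖z‖ := by
      have hpi : |Real.pi| = Real.pi := abs_of_pos Real.pi_pos
      rw [hb]
      simp only [norm_div, norm_mul, Complex.norm_real, Real.norm_eq_abs, hpi, abs_pow,
        abs_of_pos hv]
      have := Real.pi_ne_zero
      field_simp
    rw [e1, Complex.norm_cpow_real, e2, Real.div_rpow (by positivity) (norm_nonneg _),
      Real.rpow_neg (norm_nonneg _), sq_rpow_natCast_half hv.le]
    ring
  rw [h2]
  exact mul_le_of_le_one_right (by positivity) h1

variable (E) in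
open Set in
/-- The dispersive estimate behind the example: the Fourier transform of `e^{-2π z |ξ|}` is bounded
by a multiple of `(Re z)^{-(k + 1) / 2}`, whatever the imaginary part of `z`. -/
theorem exists_norm_fourier_exp_neg_norm_le (hk : 1 ≤ Module.finrank ℝ E) :
    ∃ C : ℝ, 0 < C ∧ ∀ z : ℂ, 0 < z.re → 1 ≤ ‖z‖ → ∀ x : E,
      ‖∫ ξ : E, Complex.exp (2 * Real.pi * Complex.I * (inner ℝ x ξ : ℝ)) *
        Complex.exp (-(2 * Real.pi * z * ‖ξ‖))‖ ≤
        C * z.re ^ (-((Module.finrank ℝ E : ℝ) + 1) / 2) := by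
  set k := Module.finrank ℝ E with hkdef
  set D : ℝ := Real.pi ^ (-((k : ℝ) + 1) / 2) * (1 / 2) * Real.Gamma (((k : ℝ) + 1) / 2) with hD
  have hDpos : 0 < D := by
    have : 0 < Real.Gamma (((k : ℝ) + 1) / 2) := Real.Gamma_pos_of_pos (by positivity)
    positivity
  refine ⟨2 * D, by positivity, fun z hz hz1 x => ?_⟩
  have hz0 : 0 < ‖z‖ := by linarith
  set c : ℂ := (1 / z) ^ (1 / 2 : ℂ) / 2 with hc
  have hcn : ‖c‖ = ‖z‖ ^ (-(1 / 2 : ℝ)) / 2 := by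
    have : (1 / 2 : ℂ) = ((1 / 2 : ℝ) : ℂ) := by
      push_cast
      rfl
    rw [hc, norm_div, this, Complex.norm_cpow_real, norm_div, norm_one, one_div,
      Real.inv_rpow hz0.le, Real.rpow_neg hz0.le]
    norm_num
  set F : E → ℝ → ℂ := fun ξ v => Complex.exp (2 * Real.pi * Complex.I * (inner ℝ x ξ : ℝ)) *
    Complex.exp (-(Real.pi * z) * ((v ^ 2 + ‖ξ‖ ^ 2 / v ^ 2 : ℝ) : ℂ)) with hF
  have hFint : Integrable (Function.uncurry F)
      ((volume : Measure E).prod (volume.restrict (Ioi (0 : ℝ)))) := by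
    refine (integrable_subordination (E := E) hz).bdd_mul (c := 1) ?_ ?_
    · refine Measurable.aestronglyMeasurable ?_
      fun_prop
    · refine Filter.Eventually.of_forall fun q => ?_
      rw [Complex.norm_exp]
      simp
  have hswap := integral_integral_swap hFint
  have hleft : ∫ ξ : E, ∫ v in Ioi (0 : ℝ), F ξ v =
      (∫ ξ : E, Complex.exp (2 * Real.pi * Complex.I * (inner ℝ x ξ : ℝ)) *
        Complex.exp (-(2 * Real.pi * z * ‖ξ‖))) * c := by
    rw [← integral_mul_const]
    refine integral_congr_ae (Filter.Eventually.of_forall fun ξ => ?_)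
    simp only [hF]
    rw [integral_const_mul, integral_subordination hz (norm_nonneg _)]
    ring
  have hright : ‖∫ v in Ioi (0 : ℝ), ∫ ξ : E, F ξ v‖ ≤
      ‖z‖ ^ (-(k / 2 : ℝ)) * (z.re ^ (-((k : ℝ) + 1) / 2) * D) := by
    rw [← (integral_pow_mul_gaussian hz k).2, ← integral_const_mul]
    refine norm_integral_le_of_norm_le ((integral_pow_mul_gaussian hz k).1.const_mul _) ?_
    refine (ae_restrict_mem measurableSet_Ioi).mono fun v (hv : 0 < v) => ?_
    have : ∀ ξ : E, F ξ v = Complex.exp (-(Real.pi * z) * ((v ^ 2 : ℝ) : ℂ)) *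
        Complex.exp (-(Real.pi * z / ((v ^ 2 : ℝ) : ℂ)) * (‖ξ‖ : ℂ) ^ 2 +
          2 * Real.pi * Complex.I * (inner ℝ x ξ : ℝ)) := by
      intro ξ
      simp only [hF, subordination_exponent, Complex.exp_add]
      ring
    simp only [this]
    rw [integral_const_mul, norm_mul, norm_cexp_neg_pi_mul]
    calc _ ≤ Real.exp (-(Real.pi * z.re) * v ^ 2) * (v ^ k * ‖z‖ ^ (-(k / 2 : ℝ))) := by
          gcongr
          exact norm_fourier_gaussian_le hz hv x
      _ = _ := by ring
  rw [← hswap, hleft, norm_mul, hcn] at hright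
  set I := ‖∫ ξ : E, Complex.exp (2 * Real.pi * Complex.I * (inner ℝ x ξ : ℝ)) *
        Complex.exp (-(2 * Real.pi * z * ‖ξ‖))‖
  have hk' : ‖z‖ ^ (-(k / 2 : ℝ)) ≤ ‖z‖ ^ (-(1 / 2 : ℝ)) := by
    refine Real.rpow_le_rpow_of_exponent_le hz1 ?_
    have : (1 : ℝ) ≤ k := by exact_mod_cast hk
    linarith
  have hp : 0 < ‖z‖ ^ (-(1 / 2 : ℝ)) := Real.rpow_pos_of_pos hz0 _
  have hq : 0 ≤ z.re ^ (-((k : ℝ) + 1) / 2) * D := by positivity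
  have h3 : I * (‖z‖ ^ (-(1 / 2 : ℝ)) / 2) ≤
      ‖z‖ ^ (-(1 / 2 : ℝ)) * (z.re ^ (-((k : ℝ) + 1) / 2) * D) :=
    hright.trans (mul_le_mul_of_nonneg_right hk' hq)
  have h4 : ‖z‖ ^ (-(1 / 2 : ℝ)) * I ≤
      ‖z‖ ^ (-(1 / 2 : ℝ)) * (2 * D * z.re ^ (-((k : ℝ) + 1) / 2)) := by linarith
  exact le_of_mul_le_mul_left h4 hp

end HalfWave

/-! ### Complex exponentials of the sum of the block norms -/

section ProductSpace

variable {d : ℕ} {n : Fin d → ℕ}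

/-- The sum `∑ i, |ξ_i|` of the block norms, the nonlinear part of the phase. -/
noncomputable def blockNormSum (ξ : MultiSpace n) : ℝ := ∑ i, ‖ξ i‖

/-- The total dimension `∑ i, n i`, as a real number. -/
noncomputable def totalDim (n : Fin d → ℕ) : ℝ := ((∑ i, n i : ℕ) : ℝ)

theorem exists_map_volume_eq_smul (n : Fin d → ℕ) :
    ∃ c : ℝ≥0∞, c ≠ ⊤ ∧
      (volume : Measure (MultiSpace n)).map
        (PiLp.continuousLinearEquiv 2 ℝ fun i => EuclideanSpace ℝ (Fin (n i))) =
      c • (volume : Measure (∀ i, EuclideanSpace ℝ (Fin (n i)))) := by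
  have := (PiLp.continuousLinearEquiv 2 ℝ
    fun i => EuclideanSpace ℝ (Fin (n i))).isAddHaarMeasure_map (volume : Measure (MultiSpace n))
  exact ⟨_, ENNReal.coe_ne_top, Measure.isAddLeftInvariant_eq_smul _ _⟩

/-- Fubini's theorem for products of functions of the blocks. The constant compares the volume of
`MultiSpace n` with the product measure; its value `1` is never needed. -/
theorem exists_integral_prod_blocks (n : Fin d → ℕ) :
    ∃ c : ℝ, 0 ≤ c ∧ ∀ f : ∀ i, EuclideanSpace ℝ (Fin (n i)) → ℂ, (∀ i, Integrable (f i)) →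
      Integrable (fun ξ : MultiSpace n => ∏ i, f i (ξ i)) ∧
      ∫ ξ : MultiSpace n, ∏ i, f i (ξ i) = c * ∏ i, ∫ η, f i η := by
  obtain ⟨c, hc, h⟩ := exists_map_volume_eq_smul n
  set e := PiLp.continuousLinearEquiv 2 ℝ fun i => EuclideanSpace ℝ (Fin (n i))
  have hemb : MeasurableEmbedding e := e.toHomeomorph.measurableEmbedding
  refine ⟨c.toReal, ENNReal.toReal_nonneg, fun f hf => ⟨?_, ?_⟩⟩
  · have := (Integrable.fintype_prod_dep hf).smul_measure hc
    rw [← volume_pi, ← h, hemb.integrable_map_iff] at this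
    exact this
  · have h1 : ∫ ξ : MultiSpace n, ∏ i, f i (ξ i) =
        ∫ y, ∏ i, f i (y i) ∂((volume : Measure (MultiSpace n)).map e) := by
      rw [hemb.integral_map]
      rfl
    rw [h1, h, integral_smul_measure, integral_fintype_prod_volume_eq_prod]
    simp

theorem cexp_neg_blockNormSum (z : ℂ) (ξ : MultiSpace n) :
    Complex.exp (-(2 * Real.pi * z * blockNormSum ξ)) =
      ∏ i, Complex.exp (-(2 * Real.pi * z * ‖ξ i‖)) := by
  rw [← Complex.exp_sum]
  congr 1
  simp [blockNormSum, Finset.mul_sum]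

theorem cexp_inner_mul_cexp_neg_blockNormSum (z : ℂ) (x ξ : MultiSpace n) :
    Complex.exp (2 * Real.pi * Complex.I * (inner ℝ x ξ : ℝ)) *
      Complex.exp (-(2 * Real.pi * z * blockNormSum ξ)) =
      ∏ i, (Complex.exp (2 * Real.pi * Complex.I * (inner ℝ (x i) (ξ i) : ℝ)) *
        Complex.exp (-(2 * Real.pi * z * ‖ξ i‖))) := by
  rw [cexp_neg_blockNormSum, Finset.prod_mul_distrib]
  congr 1
  rw [PiLp.inner_apply, Complex.ofReal_sum, Finset.mul_sum, Complex.exp_sum]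

theorem norm_cexp_two_pi_I_mul (t : ℝ) : ‖Complex.exp (2 * Real.pi * Complex.I * (t : ℂ))‖ = 1 := by
  rw [Complex.norm_exp]
  simp

theorem integrable_exp_neg_blockNormSum {z : ℂ} (hz : 0 < z.re) :
    Integrable (fun ξ : MultiSpace n => Complex.exp (-(2 * Real.pi * z * blockNormSum ξ))) := by
  obtain ⟨c, -, h⟩ := exists_integral_prod_blocks n
  simp only [cexp_neg_blockNormSum]
  exact (h (fun i η => Complex.exp (-(2 * Real.pi * z * ‖η‖)))
    fun i => integrable_exp_neg_norm hz).1

theorem exists_norm_fourier_exp_neg_blockNormSum_le (hn : ∀ i, 1 ≤ n i) :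
    ∃ C : ℝ, 0 ≤ C ∧ ∀ z : ℂ, 0 < z.re → 1 ≤ ‖z‖ → ∀ x : MultiSpace n,
      ‖∫ ξ : MultiSpace n, Complex.exp (2 * Real.pi * Complex.I * (inner ℝ x ξ : ℝ)) *
        Complex.exp (-(2 * Real.pi * z * blockNormSum ξ))‖ ≤
        C * z.re ^ (-(totalDim n + d) / 2) := by
  obtain ⟨c, hc, h⟩ := exists_integral_prod_blocks n
  have hA := fun i => exists_norm_fourier_exp_neg_norm_le (EuclideanSpace ℝ (Fin (n i)))
    (by simpa using hn i)
  choose A hA0 hA using hA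
  simp only [finrank_euclideanSpace_fin] at hA
  refine ⟨c * ∏ i, A i, mul_nonneg hc (Finset.prod_nonneg fun i _ => (hA0 i).le),
    fun z hz hz1 x => ?_⟩
  simp only [cexp_inner_mul_cexp_neg_blockNormSum]
  have hint : ∀ i, Integrable fun η : EuclideanSpace ℝ (Fin (n i)) =>
      Complex.exp (2 * Real.pi * Complex.I * (inner ℝ (x i) η : ℝ)) *
        Complex.exp (-(2 * Real.pi * z * ‖η‖)) := by
    intro i
    refine (integrable_exp_neg_norm hz).bdd_mul (c := 1) ?_ ?_
    · refine Continuous.aestronglyMeasurable ?_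
      fun_prop
    · exact Filter.Eventually.of_forall fun η => (norm_cexp_two_pi_I_mul _).le
  rw [(h (fun i η => Complex.exp (2 * Real.pi * Complex.I * (inner ℝ (x i) η : ℝ)) *
        Complex.exp (-(2 * Real.pi * z * ‖η‖))) hint).2, norm_mul, norm_prod, Complex.norm_real,
        Real.norm_of_nonneg hc, mul_assoc c]
  refine mul_le_mul_of_nonneg_left ?_ hc
  have hexp : z.re ^ (-(totalDim n + d) / 2) = ∏ i, z.re ^ (-((n i : ℝ) + 1) / 2) := by
    rw [← Real.rpow_sum_of_pos hz]
    congr 1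
    simp only [totalDim, ← Finset.sum_div, Finset.sum_neg_distrib, Finset.sum_add_distrib]
    simp
  rw [hexp, ← Finset.prod_mul_distrib]
  exact Finset.prod_le_prod (fun i _ => norm_nonneg _) fun i _ => hA i z hz hz1 (x i)

/-- Inserting a Schwartz multiplier at scale `1 / ε` does not spoil the dispersive estimate, since
it amounts to averaging over translations with an integrable weight. -/
theorem exists_norm_fourier_exp_neg_mul_schwartz_le (hn : ∀ i, 1 ≤ n i)
    (θ : 𝓢(MultiSpace n, ℂ)) :
    ∃ C : ℝ, 0 ≤ C ∧ ∀ z : ℂ, 0 < z.re → 1 ≤ ‖z‖ → ∀ x : MultiSpace n,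
      ‖∫ ξ : MultiSpace n, Complex.exp (2 * Real.pi * Complex.I * (inner ℝ x ξ : ℝ)) *
        (Complex.exp (-(2 * Real.pi * z * blockNormSum ξ)) * θ (z.re • ξ))‖ ≤
        C * z.re ^ (-(totalDim n + d) / 2) := by
  obtain ⟨C, hC, h⟩ := exists_norm_fourier_exp_neg_blockNormSum_le hn
  set φ : 𝓢(MultiSpace n, ℂ) := 𝓕⁻ θ with hφ
  refine ⟨C * ∫ y, ‖φ y‖, mul_nonneg hC (integral_nonneg fun y => norm_nonneg _),
    fun z hz hz1 x => ?_⟩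
  have hθ : ∀ ξ, θ ξ = ∫ y, Complex.exp (-(2 * Real.pi * Complex.I * (inner ℝ y ξ : ℝ))) * φ y := by
    intro ξ
    have : θ = 𝓕 φ := by simp [hφ]
    rw [this, SchwartzMap.fourier_coe, Real.fourier_eq']
    refine integral_congr_ae (Filter.Eventually.of_forall fun y => ?_)
    simp only [smul_eq_mul]
    congr 2
    push_cast
    ring
  set F : MultiSpace n → MultiSpace n → ℂ := fun ξ y =>
    Complex.exp (2 * Real.pi * Complex.I * ((inner ℝ x ξ - inner ℝ y (z.re • ξ) : ℝ) : ℂ)) *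
      (Complex.exp (-(2 * Real.pi * z * blockNormSum ξ)) * φ y) with hF
  have hFint : Integrable (Function.uncurry F) (volume.prod volume) := by
    refine ((integrable_exp_neg_blockNormSum hz).mul_prod φ.integrable).bdd_mul (c := 1) ?_ ?_
    · refine Continuous.aestronglyMeasurable ?_
      fun_prop
    · exact Filter.Eventually.of_forall fun η => (norm_cexp_two_pi_I_mul _).le
  have hswap := integral_integral_swap hFint
  have hleft : ∀ ξ, ∫ y, F ξ y = Complex.exp (2 * Real.pi * Complex.I * (inner ℝ x ξ : ℝ)) *
        (Complex.exp (-(2 * Real.pi * z * blockNormSum ξ)) * θ (z.re • ξ)) := by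
    intro ξ
    rw [hθ, ← integral_const_mul, ← integral_const_mul]
    refine integral_congr_ae (Filter.Eventually.of_forall fun y => ?_)
    simp only [hF, Complex.ofReal_sub, mul_sub, Complex.exp_sub, Complex.exp_neg]
    ring
  simp only [hleft] at hswap
  rw [hswap, mul_right_comm, ← integral_const_mul]
  refine norm_integral_le_of_norm_le (φ.integrable.norm.const_mul _)
    (Filter.Eventually.of_forall fun y => ?_)
  have hright : ∫ ξ, F ξ y = φ y * ∫ ξ : MultiSpace n,
      Complex.exp (2 * Real.pi * Complex.I * (inner ℝ (x - z.re • y) ξ : ℝ)) *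
        Complex.exp (-(2 * Real.pi * z * blockNormSum ξ)) := by
    rw [← integral_const_mul]
    refine integral_congr_ae (Filter.Eventually.of_forall fun ξ => ?_)
    simp only [hF, inner_sub_left, real_inner_smul_left, real_inner_smul_right]
    ring
  rw [hright, norm_mul, mul_comm]
  exact mul_le_mul_of_nonneg_right (h z hz hz1 _) (norm_nonneg _)

end ProductSpace

/-! ### Dilations of Schwartz functions -/

section Dilation

open scoped LineDeriv

variable {V : Type*} [NormedAddCommGroup V] [InnerProductSpace ℝ V]


/-- The dilation `ξ ↦ f (l⁻¹ ξ)` of a Schwartz function. -/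
noncomputable def schwartzDilation (l : ℝ) (hl : l ≠ 0) (f : 𝓢(V, ℂ)) : 𝓢(V, ℂ) :=
  SchwartzMap.compCLMOfContinuousLinearEquiv ℂ
    (ContinuousLinearEquiv.smulLeft (R₁ := ℝ) (Units.mk0 l⁻¹ (inv_ne_zero hl))) f

theorem schwartzDilation_apply {l : ℝ} (hl : l ≠ 0) (f : 𝓢(V, ℂ)) (ξ : V) :
    schwartzDilation l hl f ξ = f (l⁻¹ • ξ) := rfl

theorem lineDeriv_schwartzDilation {l : ℝ} (hl : l ≠ 0) (f : 𝓢(V, ℂ)) (m ξ : V) :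
    (∂_{m} (schwartzDilation l hl f)) ξ = ((l⁻¹ : ℝ) : ℂ) * (∂_{m} f) (l⁻¹ • ξ) := by
  rw [SchwartzMap.lineDerivOp_apply_eq_fderiv, SchwartzMap.lineDerivOp_apply_eq_fderiv]
  have : (schwartzDilation l hl f : V → ℂ) = fun ξ => f (l⁻¹ • ξ) := rfl
  rw [this, fderiv_comp_smul]
  simp

variable [FiniteDimensional ℝ V] [MeasurableSpace V] [BorelSpace V]

theorem fourierInv_schwartz_apply (f : 𝓢(V, ℂ)) (x : V) :
    (𝓕⁻ f) x = ∫ ξ, Complex.exp (2 * Real.pi * Complex.I * (inner ℝ x ξ : ℝ)) * f ξ := by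
  rw [SchwartzMap.fourierInv_coe, Real.fourierInv_eq']
  refine integral_congr_ae (Filter.Eventually.of_forall fun ξ => ?_)
  simp only [smul_eq_mul, real_inner_comm ξ x]
  congr 2
  push_cast
  ring

theorem fourierInv_schwartzDilation {l : ℝ} (hl : 0 < l) (f : 𝓢(V, ℂ)) (x : V) :
    (𝓕⁻ (schwartzDilation l hl.ne' f)) x = ((l ^ Module.finrank ℝ V : ℝ) : ℂ) * (𝓕⁻ f) (l • x) := by
  rw [fourierInv_schwartz_apply, fourierInv_schwartz_apply]
  have h := Measure.integral_comp_inv_smul_of_nonneg (volume : Measure V) (fun ξ : V =>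
    Complex.exp (2 * Real.pi * Complex.I * (inner ℝ (l • x) ξ : ℝ)) * f ξ) hl.le
  rw [Complex.real_smul] at h
  rw [← h]
  refine integral_congr_ae (Filter.Eventually.of_forall fun ξ => ?_)
  simp only [schwartzDilation_apply, real_inner_smul_left, real_inner_smul_right,
    inv_mul_cancel_left₀ hl.ne']

theorem integral_norm_sq_fourierInv (f : 𝓢(V, ℂ)) :
    ∫ x, ‖(𝓕⁻ f) x‖ ^ 2 = ∫ ξ, ‖f ξ‖ ^ 2 := by
  rw [← SchwartzMap.integral_norm_sq_fourier, FourierTransform.fourier_fourierInv_eq]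

theorem integrable_norm_sq_schwartz (f : 𝓢(V, ℂ)) : Integrable (fun x => ‖f x‖ ^ 2) :=
  (memLp_two_iff_integrable_sq_norm f.continuous.aestronglyMeasurable).1 (f.memLp 2)

theorem integral_norm_sq_fourierInv_schwartzDilation {l : ℝ} (hl : 0 < l) (f : 𝓢(V, ℂ)) :
    ∫ x, ‖(𝓕⁻ (schwartzDilation l hl.ne' f)) x‖ ^ 2 =
      l ^ Module.finrank ℝ V * ∫ ξ, ‖f ξ‖ ^ 2 := by
  rw [integral_norm_sq_fourierInv]
  exact Measure.integral_comp_inv_smul_of_nonneg volume (fun ξ => ‖f ξ‖ ^ 2) hl.le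

theorem fourierInv_lineDeriv_apply (f : 𝓢(V, ℂ)) (m x : V) :
    (𝓕⁻ (∂_{m} f)) x = -(2 * Real.pi * Complex.I) * ((inner ℝ x m : ℝ) * (𝓕⁻ f) x) := by
  have : (inner ℝ · m).HasTemperateGrowth := ((innerSL ℝ).flip m).hasTemperateGrowth
  rw [SchwartzMap.fourierInv_lineDerivOp_eq]
  simp [SchwartzMap.smulLeftCLM_apply_apply this]

/-- The second moment of an inverse Fourier transform at scale `l`, in terms of the gradient: by
Plancherel's theorem, multiplication by a coordinate is differentiation. -/
theorem integral_norm_sq_mul_fourierInv_schwartzDilation_le {l : ℝ} (hl : 0 < l) (f : 𝓢(V, ℂ))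
    {B : V → ℝ} (hB : Integrable (fun ξ => B ξ ^ 2))
    (hf : ∀ ξ, ‖fderiv ℝ f ξ‖ ≤ 2 * l * B ξ) :
    Integrable (fun x => ‖x‖ ^ 2 * ‖(𝓕⁻ (schwartzDilation l hl.ne' f)) x‖ ^ 2) ∧
    ∫ x, ‖x‖ ^ 2 * ‖(𝓕⁻ (schwartzDilation l hl.ne' f)) x‖ ^ 2 ≤
      l ^ Module.finrank ℝ V * (Module.finrank ℝ V * ∫ ξ, B ξ ^ 2) := by
  set W := schwartzDilation l hl.ne' f with hW
  set b := stdOrthonormalBasis ℝ V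
  have hpt : ∀ m x : V, ‖(𝓕⁻ (∂_{m} W)) x‖ ^ 2 =
      (2 * Real.pi) ^ 2 * (‖(inner ℝ x m : ℝ)‖ ^ 2 * ‖(𝓕⁻ W) x‖ ^ 2) := by
    intro m x
    rw [fourierInv_lineDeriv_apply]
    simp only [norm_mul, norm_neg, Complex.norm_ofNat, Complex.norm_real, Complex.norm_I,
      Real.norm_eq_abs, abs_of_pos Real.pi_pos]
    ring
  have hint : ∀ m : V, Integrable (fun x => ‖(inner ℝ x m : ℝ)‖ ^ 2 * ‖(𝓕⁻ W) x‖ ^ 2) := by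
    intro m
    refine ((integrable_norm_sq_schwartz (𝓕⁻ (∂_{m} W))).const_mul ((2 * Real.pi) ^ 2)⁻¹).congr
      (Filter.Eventually.of_forall fun x => ?_)
    have : (2 * Real.pi) ^ 2 ≠ 0 := by positivity
    simp only [hpt]
    rw [inv_mul_cancel_left₀ this]
  have hsum : (fun x => ‖x‖ ^ 2 * ‖(𝓕⁻ W) x‖ ^ 2) =
      fun x => ∑ i, ‖(inner ℝ x (b i) : ℝ)‖ ^ 2 * ‖(𝓕⁻ W) x‖ ^ 2 := by
    funext x
    rw [← b.sum_sq_norm_inner_left x, Finset.sum_mul]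
  have hone : ∀ i, ∫ x, ‖(inner ℝ x (b i) : ℝ)‖ ^ 2 * ‖(𝓕⁻ W) x‖ ^ 2 ≤
      l ^ Module.finrank ℝ V * ∫ ξ, B ξ ^ 2 := by
    intro i
    have h1 : (2 * Real.pi) ^ 2 * ∫ x, ‖(inner ℝ x (b i) : ℝ)‖ ^ 2 * ‖(𝓕⁻ W) x‖ ^ 2 =
        ∫ ξ, ‖(∂_{b i} W) ξ‖ ^ 2 := by
      rw [← integral_norm_sq_fourierInv, ← integral_const_mul]
      simp only [hpt]
    have h2 : ∫ ξ, ‖(∂_{b i} W) ξ‖ ^ 2 ≤ ∫ ξ, 4 * B (l⁻¹ • ξ) ^ 2 := by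
      refine integral_mono (integrable_norm_sq_schwartz _)
        ((hB.comp_smul (inv_ne_zero hl.ne')).const_mul 4) fun ξ => ?_
      have h3 : ‖(∂_{b i} W) ξ‖ ≤ 2 * B (l⁻¹ • ξ) := by
        rw [hW, lineDeriv_schwartzDilation, norm_mul, SchwartzMap.lineDerivOp_apply_eq_fderiv]
        have h4 := (fderiv ℝ f (l⁻¹ • ξ)).le_of_opNorm_le (hf _) (b i)
        rw [b.norm_eq_one, mul_one] at h4
        calc _ ≤ ‖((l⁻¹ : ℝ) : ℂ)‖ * (2 * l * B (l⁻¹ • ξ)) := by gcongr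
          _ = 2 * B (l⁻¹ • ξ) := by
            rw [Complex.norm_real, Real.norm_of_nonneg (inv_nonneg.2 hl.le)]
            field_simp
      calc ‖(∂_{b i} W) ξ‖ ^ 2 ≤ (2 * B (l⁻¹ • ξ)) ^ 2 := by gcongr
        _ = _ := by ring
    rw [integral_const_mul, Measure.integral_comp_inv_smul_of_nonneg volume
      (fun ξ => B ξ ^ 2) hl.le, smul_eq_mul, ← h1] at h2
    have hpi : 4 ≤ (2 * Real.pi) ^ 2 := by nlinarith [Real.pi_gt_three]
    have h0 : 0 ≤ ∫ x, ‖(inner ℝ x (b i) : ℝ)‖ ^ 2 * ‖(𝓕⁻ W) x‖ ^ 2 :=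
      integral_nonneg fun x => by positivity
    nlinarith
  rw [hsum]
  refine ⟨integrable_finsetSum _ fun i _ => hint (b i), ?_⟩
  rw [integral_finsetSum _ fun i _ => hint (b i)]
  calc _ ≤ ∑ _i : Fin (Module.finrank ℝ V), l ^ Module.finrank ℝ V * ∫ ξ, B ξ ^ 2 :=
        Finset.sum_le_sum fun i _ => hone i
    _ = _ := by
      rw [Finset.sum_const, Finset.card_univ, Fintype.card_fin, nsmul_eq_mul]
      ring

end Dilation

/-! ### Half-waves at high frequency -/

section WavePackets

variable {d : ℕ} {n : Fin d → ℕ}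

theorem finrank_multiSpace (n : Fin d → ℕ) :
    Module.finrank ℝ (MultiSpace n) = ∑ i, n i := by
  rw [(PiLp.continuousLinearEquiv 2 ℝ
    fun i => EuclideanSpace ℝ (Fin (n i))).toLinearEquiv.finrank_eq, Module.finrank_pi_fintype]
  simp

theorem pow_finrank_multiSpace (n : Fin d → ℕ) (l : ℝ) :
    l ^ Module.finrank ℝ (MultiSpace n) = l ^ totalDim n := by
  rw [finrank_multiSpace, totalDim, Real.rpow_natCast]

/-- A nonnegative, nonzero smooth function of compact support, all of whose support satisfies
`|ξ_i| ≥ 1` for every block `i`. -/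
structure IsBlockBump (χ : MultiSpace n → ℝ) : Prop where
  contDiff : ContDiff ℝ ∞ χ
  hasCompactSupport : HasCompactSupport χ
  one_le_norm : ∀ ξ ∈ tsupport χ, ∀ i, 1 ≤ ‖ξ i‖
  nonneg : ∀ ξ, 0 ≤ χ ξ
  exists_pos : ∃ ξ, 0 < χ ξ

theorem exists_isBlockBump (hn : ∀ i, 1 ≤ n i) : ∃ χ : MultiSpace n → ℝ, IsBlockBump χ := by
  -- a bump of radius `1` about a point all of whose blocks have norm `2`
  let c : MultiSpace n := WithLp.toLp 2 fun i =>
    EuclideanSpace.single (⟨0, hn i⟩ : Fin (n i)) (2 : ℝ)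
  let f : ContDiffBump c := ⟨1 / 2, 1, by norm_num, by norm_num⟩
  refine ⟨f, f.contDiff, f.hasCompactSupport, fun ξ hξ i => ?_, fun ξ => f.nonneg,
    c, f.pos_of_mem_ball (by simp [f.rOut_pos])⟩
  rw [f.tsupport_eq, Metric.mem_closedBall, dist_eq_norm] at hξ
  have h1 : ‖ξ i - c i‖ ≤ 1 := (PiLp.norm_apply_le (ξ - c) i).trans hξ
  have h2 : ‖c i‖ = 2 := by simp [c]
  have h3 := norm_sub_norm_le (c i) (ξ i)
  rw [norm_sub_rev] at h3
  linarith

variable {χ : MultiSpace n → ℝ}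

namespace IsBlockBump

theorem mem_tsupport {ξ : MultiSpace n} (h : χ ξ ≠ 0) : ξ ∈ tsupport χ :=
  subset_tsupport _ h

theorem one_le_norm' (hχ : IsBlockBump χ) [Nonempty (Fin d)] {ξ : MultiSpace n}
    (h : ξ ∈ tsupport χ) : 1 ≤ ‖ξ‖ :=
  (hχ.one_le_norm ξ h (Classical.arbitrary _)).trans (PiLp.norm_apply_le ξ _)

theorem contDiff_mul (hχ : IsBlockBump χ) {h : MultiSpace n → ℂ}
    (hh : ∀ ξ ∈ tsupport χ, ContDiffAt ℝ ∞ h ξ) :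
    ContDiff ℝ ∞ (fun ξ => h ξ * (χ ξ : ℂ)) := by
  refine contDiff_iff_contDiffAt.2 fun ξ => ?_
  by_cases hξ : ξ ∈ tsupport χ
  · exact (hh ξ hξ).mul (Complex.ofRealCLM.contDiff.contDiffAt.comp ξ hχ.contDiff.contDiffAt)
  · have : (fun ξ => h ξ * (χ ξ : ℂ)) =ᶠ[nhds ξ] fun _ => 0 := by
      filter_upwards [notMem_tsupport_iff_eventuallyEq.1 hξ] with η hη
      simp [hη]
    exact contDiffAt_const.congr_of_eventuallyEq this

/-- The Schwartz function `h χ`, for `h` smooth near the support of `χ`. -/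
noncomputable def mulSchwartz (hχ : IsBlockBump χ) (h : MultiSpace n → ℂ)
    (hh : ∀ ξ ∈ tsupport χ, ContDiffAt ℝ ∞ h ξ) : 𝓢(MultiSpace n, ℂ) :=
  HasCompactSupport.toSchwartzMap (f := fun ξ => h ξ * (χ ξ : ℂ))
    ((hχ.hasCompactSupport.comp_left (g := fun t : ℝ => (t : ℂ)) Complex.ofReal_zero).mul_left)
    (hχ.contDiff_mul hh)

theorem mulSchwartz_apply (hχ : IsBlockBump χ) (h : MultiSpace n → ℂ)
    (hh : ∀ ξ ∈ tsupport χ, ContDiffAt ℝ ∞ h ξ) (ξ : MultiSpace n) :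
    hχ.mulSchwartz h hh ξ = h ξ * (χ ξ : ℂ) := rfl

theorem contDiffAt_blockNormSum (hχ : IsBlockBump χ) {ξ : MultiSpace n} (hξ : ξ ∈ tsupport χ) :
    ContDiffAt ℝ ∞ (blockNormSum (n := n)) ξ := by
  unfold blockNormSum
  refine ContDiffAt.sum fun i _ => ?_
  have h0 : ξ i ≠ 0 := by
    have := hχ.one_le_norm ξ hξ i
    intro h
    rw [h, norm_zero] at this
    linarith
  have h1 : ContDiff ℝ ∞ (fun ξ : MultiSpace n => ξ i) := by fun_prop
  exact h1.contDiffAt.norm ℝ h0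

theorem contDiffAt_cexp_mul_blockNormSum (hχ : IsBlockBump χ) (w : ℂ) {ξ : MultiSpace n}
    (hξ : ξ ∈ tsupport χ) : ContDiffAt ℝ ∞ (fun ξ => Complex.exp (w * blockNormSum ξ)) ξ :=
  (contDiffAt_const.mul
    (Complex.ofRealCLM.contDiff.contDiffAt.comp ξ (hχ.contDiffAt_blockNormSum hξ))).cexp

theorem contDiffAt_norm_rpow (hχ : IsBlockBump χ) [Nonempty (Fin d)] (s : ℝ) {ξ : MultiSpace n}
    (hξ : ξ ∈ tsupport χ) :
    ContDiffAt ℝ ∞ (fun ξ : MultiSpace n => ((‖ξ‖ ^ s : ℝ) : ℂ)) ξ := by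
  have h0 : 0 < ‖ξ‖ := by linarith [hχ.one_le_norm' hξ]
  have : ContDiffAt ℝ ∞ (fun ξ : MultiSpace n => ‖ξ‖ ^ s) ξ :=
    (contDiffAt_id.norm ℝ (norm_pos_iff.1 h0)).rpow_const_of_ne h0.ne'
  exact Complex.ofRealCLM.contDiff.contDiffAt.comp ξ this

/-- The frequency profile `e^{2π i μ ∑ |ξ_i|} χ(ξ)`. Dilated by `l`, with `μ = ± l`, it is the
Fourier transform of a half-wave at frequency `l` and time `± 1`. -/
noncomputable def halfWave (hχ : IsBlockBump χ) (μ : ℝ) : 𝓢(MultiSpace n, ℂ) :=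
  hχ.mulSchwartz (fun ξ => Complex.exp (2 * Real.pi * Complex.I * μ * blockNormSum ξ))
    fun _ hξ => hχ.contDiffAt_cexp_mul_blockNormSum _ hξ

/-- The frequency profile `|ξ|^s χ(ξ)`. -/
noncomputable def rieszBump (hχ : IsBlockBump χ) [Nonempty (Fin d)] (s : ℝ) : 𝓢(MultiSpace n, ℂ) :=
  hχ.mulSchwartz (fun ξ => ((‖ξ‖ ^ s : ℝ) : ℂ)) fun _ hξ => hχ.contDiffAt_norm_rpow s hξ

theorem halfWave_apply (hχ : IsBlockBump χ) (μ : ℝ) (ξ : MultiSpace n) :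
    hχ.halfWave μ ξ = Complex.exp (2 * Real.pi * Complex.I * μ * blockNormSum ξ) * χ ξ := rfl

theorem rieszBump_apply (hχ : IsBlockBump χ) [Nonempty (Fin d)] (s : ℝ) (ξ : MultiSpace n) :
    hχ.rieszBump s ξ = ((‖ξ‖ ^ s : ℝ) : ℂ) * χ ξ := rfl

theorem norm_halfWave (hχ : IsBlockBump χ) (μ : ℝ) (ξ : MultiSpace n) :
    ‖hχ.halfWave μ ξ‖ = χ ξ := by
  have : (2 * Real.pi * Complex.I * μ * blockNormSum ξ : ℂ) =
      2 * Real.pi * Complex.I * ((μ * blockNormSum ξ : ℝ) : ℂ) := by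
    push_cast
    ring
  rw [halfWave_apply, norm_mul, this, norm_cexp_two_pi_I_mul, one_mul, Complex.norm_real,
    Real.norm_of_nonneg (hχ.nonneg ξ)]

theorem integral_sq_pos (hχ : IsBlockBump χ) : 0 < ∫ ξ, χ ξ ^ 2 := by
  obtain ⟨ξ, hξ⟩ := hχ.exists_pos
  have hc : Continuous fun ξ => χ ξ ^ 2 := hχ.contDiff.continuous.pow 2
  exact hc.integral_pos_of_hasCompactSupport_nonneg_nonzero
    (hχ.hasCompactSupport.comp_left (g := fun t : ℝ => t ^ 2) (by simp))
    (fun ξ => sq_nonneg _) (x := ξ) (by positivity)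

theorem lipschitzWith_blockNormSum : LipschitzWith (d : ℝ≥0) (blockNormSum (n := n)) := by
  refine LipschitzWith.of_dist_le_mul fun ξ η => ?_
  rw [Real.dist_eq, dist_eq_norm, blockNormSum, blockNormSum, ← Finset.sum_sub_distrib]
  calc |∑ i, (‖ξ i‖ - ‖η i‖)| ≤ ∑ i, |‖ξ i‖ - ‖η i‖| := Finset.abs_sum_le_sum_abs _ _
    _ ≤ ∑ _i : Fin d, ‖ξ - η‖ := Finset.sum_le_sum fun i _ =>
      (abs_norm_sub_norm_le _ _).trans (PiLp.norm_apply_le (ξ - η) i)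
    _ = _ := by simp

/-- A bound for the gradients of the functions `hχ.halfWave μ`, up to the factor `1 + |μ|`. -/
noncomputable def gradBound (χ : MultiSpace n → ℝ) (ξ : MultiSpace n) : ℝ :=
  2 * Real.pi * d * |χ ξ| + ‖fderiv ℝ χ ξ‖

theorem gradBound_nonneg (ξ : MultiSpace n) : 0 ≤ gradBound χ ξ := by
  unfold gradBound
  positivity

theorem integrable_sq_gradBound (hχ : IsBlockBump χ) :
    Integrable (fun ξ => gradBound χ ξ ^ 2) := by
  have h1 : Continuous (fderiv ℝ χ) := hχ.contDiff.continuous_fderiv (by simp)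
  have h2 : Continuous χ := hχ.contDiff.continuous
  refine Continuous.integrable_of_hasCompactSupport ?_ ?_
  · unfold gradBound
    fun_prop
  · have : HasCompactSupport (gradBound χ) := by
      refine HasCompactSupport.add ?_ (hχ.hasCompactSupport.fderiv (𝕜 := ℝ)).norm
      exact (hχ.hasCompactSupport.comp_left (g := fun t : ℝ => |t|) abs_zero).mul_left
    exact this.comp_left (g := fun t : ℝ => t ^ 2) (by simp)

theorem norm_fderiv_halfWave_le (hχ : IsBlockBump χ) (μ : ℝ) (ξ : MultiSpace n) :
    ‖fderiv ℝ (hχ.halfWave μ) ξ‖ ≤ (1 + |μ|) * gradBound χ ξ := by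
  by_cases hξ : ξ ∈ tsupport χ
  · set w : ℂ := 2 * Real.pi * Complex.I * μ with hw
    have hS : HasFDerivAt (blockNormSum (n := n)) (fderiv ℝ blockNormSum ξ) ξ :=
      ((hχ.contDiffAt_blockNormSum hξ).differentiableAt (by simp)).hasFDerivAt
    have hχ' : HasFDerivAt χ (fderiv ℝ χ ξ) ξ :=
      (hχ.contDiff.differentiable (by simp) ξ).hasFDerivAt
    have hSC := Complex.ofRealCLM.hasFDerivAt.comp ξ hS
    have hχC := Complex.ofRealCLM.hasFDerivAt.comp ξ hχ'
    have hder := (hSC.const_mul w).cexp.mul hχC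
    have hL : ‖fderiv ℝ (blockNormSum (n := n)) ξ‖ ≤ d := by
      simpa using norm_fderiv_le_of_lipschitz ℝ (lipschitzWith_blockNormSum (n := n)) (x₀ := ξ)
    have hE : ‖Complex.exp (w * blockNormSum ξ)‖ = 1 := by
      have : w * blockNormSum ξ = 2 * Real.pi * Complex.I * ((μ * blockNormSum ξ : ℝ) : ℂ) := by
        rw [hw]
        push_cast
        ring
      rw [this, norm_cexp_two_pi_I_mul]
    have hwn : ‖w‖ = 2 * Real.pi * |μ| := by
      simp [hw, abs_of_pos Real.pi_pos]
    have heq : fderiv ℝ (hχ.halfWave μ) ξ = _ := hder.fderiv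
    have hcomp : ∀ L : MultiSpace n →L[ℝ] ℝ, ‖Complex.ofRealCLM ∘L L‖ ≤ ‖L‖ := fun L => by
      refine (ContinuousLinearMap.opNorm_comp_le _ _).trans ?_
      simp
    rw [heq]
    refine (norm_add_le _ _).trans ?_
    simp only [norm_smul, Function.comp_apply, Complex.ofRealCLM_apply, hE, one_mul, hwn,
      Complex.norm_real, Real.norm_eq_abs]
    have h1 := (hcomp (fderiv ℝ (blockNormSum (n := n)) ξ)).trans hL
    have h2 := hcomp (fderiv ℝ χ ξ)
    have h3 : |χ ξ| * (2 * Real.pi * |μ| *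
        ‖Complex.ofRealCLM ∘L fderiv ℝ (blockNormSum (n := n)) ξ‖) ≤
        |χ ξ| * (2 * Real.pi * |μ| * d) := by
      have := Real.pi_pos
      gcongr
    have h4 : 0 ≤ |μ| * ‖fderiv ℝ χ ξ‖ := by positivity
    have h5 : 0 ≤ 2 * Real.pi * d * |χ ξ| := by positivity
    unfold gradBound
    nlinarith
  · have : (hχ.halfWave μ : MultiSpace n → ℂ) =ᶠ[nhds ξ] fun _ => 0 := by
      filter_upwards [notMem_tsupport_iff_eventuallyEq.1 hξ] with η hη
      simp [halfWave_apply, hη]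
    rw [this.fderiv_eq]
    have := gradBound_nonneg (χ := χ) ξ
    simp only [fderiv_fun_const, Pi.zero_apply, norm_zero]
    positivity

/-- The half-wave at frequency `l` and time `t = ± 1` is bounded by a multiple of
`l^{(N + d) / 2}`, where `N` is the total dimension: the profile is
`e^{-2π z ∑ |ξ_i|}`, with `z = l⁻¹ - i t`, times the fixed multiplier `e^{2π ∑ |ξ_i|} χ(ξ)` at
scale `l`. -/
theorem exists_norm_fourierInv_halfWave_le (hχ : IsBlockBump χ) (hn : ∀ i, 1 ≤ n i) :
    ∃ C : ℝ, 0 ≤ C ∧ ∀ (t : ℝ), |t| = 1 → ∀ (l : ℝ) (hl : 0 < l) (x : MultiSpace n),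
      ‖(𝓕⁻ (schwartzDilation l hl.ne' (hχ.halfWave (t * l)))) x‖ ≤
        C * l ^ ((totalDim n + d) / 2) := by
  obtain ⟨C, hC, h⟩ := exists_norm_fourier_exp_neg_mul_schwartz_le hn
    (hχ.mulSchwartz (fun ξ => Complex.exp (2 * Real.pi * blockNormSum ξ))
      fun _ hξ => hχ.contDiffAt_cexp_mul_blockNormSum _ hξ)
  refine ⟨C, hC, fun t ht l hl x => ?_⟩
  set z : ℂ := (l⁻¹ : ℝ) - Complex.I * t with hz
  have hre : z.re = l⁻¹ := by simp [hz]
  have him : z.im = -t := by simp [hz]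
  have hz1 : 1 ≤ ‖z‖ := by
    have := Complex.abs_im_le_norm z
    rwa [him, abs_neg, ht] at this
  have hz0 : 0 < z.re := by
    rw [hre]
    positivity
  have h' := h z hz0 hz1 x
  have hpow : z.re ^ (-(totalDim n + d) / 2) = l ^ ((totalDim n + d) / 2) := by
    rw [hre, Real.inv_rpow hl.le, ← Real.rpow_neg hl.le]
    congr 1
    ring
  rw [hpow] at h'
  rw [fourierInv_schwartz_apply]
  refine le_of_eq_of_le ?_ h'
  congr 1
  refine integral_congr_ae (Filter.Eventually.of_forall fun ξ => ?_)
  have hS : blockNormSum (l⁻¹ • ξ) = l⁻¹ * blockNormSum ξ := by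
    simp [blockNormSum, norm_smul, Finset.mul_sum, abs_of_pos hl]
  simp only [schwartzDilation_apply, halfWave_apply, mulSchwartz_apply, hre, hS]
  rw [← mul_assoc (Complex.exp (-(2 * Real.pi * z * blockNormSum ξ))), ← Complex.exp_add]
  congr 3
  have hl0 : (l : ℂ) ≠ 0 := by exact_mod_cast hl.ne'
  rw [hz]
  push_cast
  field_simp
  ring

end IsBlockBump

end WavePackets

/-! ### The symbol -/

section Symbol

variable {V : Type*} [NormedAddCommGroup V] [InnerProductSpace ℝ V] [FiniteDimensional ℝ V]

variable (V) in
/-- A smooth function equal to `|ξ|^m` for `|ξ| ≥ 1`. -/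
noncomputable def smoothRpow (m : ℝ) (ξ : V) : ℂ :=
  (((1 - (⟨1 / 2, 1, by norm_num, by norm_num⟩ : ContDiffBump (0 : V)) ξ) * ‖ξ‖ ^ m : ℝ) : ℂ)

theorem smoothRpow_of_one_le (m : ℝ) {ξ : V} (hξ : 1 ≤ ‖ξ‖) :
    smoothRpow V m ξ = ((‖ξ‖ ^ m : ℝ) : ℂ) := by
  rw [smoothRpow, ContDiffBump.zero_of_le_dist _ (by simpa using hξ)]
  simp

theorem contDiff_smoothRpow (m : ℝ) : ContDiff ℝ ∞ (smoothRpow V m) := by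
  refine contDiff_iff_contDiffAt.2 fun ξ => ?_
  by_cases hξ : ξ = 0
  · subst hξ
    have : smoothRpow V m =ᶠ[nhds 0] fun _ => 0 := by
      filter_upwards [Metric.closedBall_mem_nhds (0 : V) (by norm_num : (0 : ℝ) < 1 / 2)] with η hη
      rw [smoothRpow, ContDiffBump.one_of_mem_closedBall _ hη]
      simp
    exact contDiffAt_const.congr_of_eventuallyEq this
  · have h1 : ContDiffAt ℝ ∞ (fun ξ : V => ‖ξ‖ ^ m) ξ :=
      (contDiffAt_id.norm ℝ hξ).rpow_const_of_ne (norm_ne_zero_iff.2 hξ)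
    exact Complex.ofRealCLM.contDiff.contDiffAt.comp ξ
      ((contDiffAt_const.sub (ContDiffBump.contDiff _).contDiffAt).mul h1)

/-- The derivatives of order `r` of `smoothRpow V m` decay like `|ξ|^{m - r}`: outside the unit
ball the function is homogeneous of degree `m`, which reduces the claim to a compact set. -/
theorem exists_norm_iteratedFDeriv_smoothRpow_le {m : ℝ} (hm : m ≤ 0) (r : ℕ) :
    ∃ C : ℝ, 0 ≤ C ∧ ∀ ξ : V, ‖iteratedFDeriv ℝ r (smoothRpow V m) ξ‖ ≤
      C * (1 + ‖ξ‖) ^ (m - r) := by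
  have hc : Continuous (iteratedFDeriv ℝ r (smoothRpow V m)) :=
    (contDiff_smoothRpow m).continuous_iteratedFDeriv (by exact_mod_cast le_top)
  obtain ⟨C, hC⟩ := (isCompact_closedBall (0 : V) 2).exists_bound_of_continuousOn hc.continuousOn
  have hC0 : 0 ≤ C := (norm_nonneg _).trans (hC 0 (by simp))
  have hmr : m - r ≤ 0 := by linarith [Nat.cast_nonneg (α := ℝ) r]
  suffices h : ∀ ξ : V, ‖iteratedFDeriv ℝ r (smoothRpow V m) ξ‖ ≤
      C * ((1 + ‖ξ‖) / 4) ^ (m - r) by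
    refine ⟨C * (4 ^ (m - r))⁻¹, by positivity, fun ξ => (h ξ).trans_eq ?_⟩
    rw [Real.div_rpow (by positivity) (by norm_num)]
    ring
  intro ξ
  rcases le_total ‖ξ‖ 2 with hξ | hξ
  · refine (hC ξ (by simpa using hξ)).trans (le_mul_of_one_le_right hC0 ?_)
    exact Real.one_le_rpow_of_pos_of_le_one_of_nonpos (by positivity) (by linarith) hmr
  · set t := ‖ξ‖ / 2 with ht
    have ht1 : 1 ≤ t := by linarith
    have ht0 : 0 < t := by linarith
    set η := t⁻¹ • ξ with hη
    have hξη : ξ = t • η := by rw [hη, smul_inv_smul₀ ht0.ne']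
    have hηn : ‖η‖ = 2 := by
      rw [hη, norm_smul, norm_inv, Real.norm_of_nonneg ht0.le, ht]
      have : ‖ξ‖ ≠ 0 := by linarith
      field_simp
    have hev : (fun y => smoothRpow V m (t • y)) =ᶠ[nhds η]
        fun y => (t ^ m) • smoothRpow V m y := by
      have : {y : V | 1 < ‖y‖} ∈ nhds η :=
        (isOpen_lt continuous_const continuous_norm).mem_nhds (by simp [hηn])
      filter_upwards [this] with y hy
      have hy : 1 < ‖y‖ := hy
      have hty : ‖t • y‖ = t * ‖y‖ := by rw [norm_smul, Real.norm_of_nonneg ht0.le]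
      rw [smoothRpow_of_one_le m hy.le, smoothRpow_of_one_le m (by rw [hty]; nlinarith), hty,
        Real.mul_rpow ht0.le (norm_nonneg _), Complex.real_smul, Complex.ofReal_mul]
    have hder := (hev.iteratedFDeriv (𝕜 := ℝ) r).eq_of_nhds
    rw [iteratedFDeriv_comp_const_smul t
      ((contDiff_smoothRpow m).of_le (by exact_mod_cast le_top)),
      iteratedFDeriv_const_smul_apply' ((contDiff_smoothRpow m).contDiffAt.of_le
        (by exact_mod_cast le_top))] at hder
    simp only [← hξη] at hder
    have hn := congrArg norm hder
    rw [norm_smul, norm_smul, Real.norm_of_nonneg (by positivity),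
      Real.norm_of_nonneg (by positivity)] at hn
    have hval : ‖iteratedFDeriv ℝ r (smoothRpow V m) ξ‖ =
        t ^ (m - r) * ‖iteratedFDeriv ℝ r (smoothRpow V m) η‖ := by
      rw [Real.rpow_sub ht0, Real.rpow_natCast, div_mul_eq_mul_div, ← hn]
      field_simp
    rw [hval, mul_comm]
    refine mul_le_mul (hC η (by simp [hηn])) ?_ (by positivity) hC0
    exact Real.rpow_le_rpow_of_nonpos (by positivity) (by linarith) hmr

end Symbol

section ProductSymbol

variable {d : ℕ} {n : Fin d → ℕ}

theorem norm_unitVec (j : Σ i : Fin d, Fin (n i)) : ‖unitVec n j‖ = 1 := by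
  have : unitVec n j = PiLp.single 2 j.1 (EuclideanSpace.single j.2 (1 : ℝ)) := rfl
  rw [this]
  simp

theorem sum_blockOrder {r : ℕ} (J : Fin r → Σ i : Fin d, Fin (n i)) :
    ∑ i, blockOrder J i = r := by
  unfold blockOrder
  rw [← Finset.card_eq_sum_card_fiberwise (fun _ _ => Finset.mem_coe.2 (Finset.mem_univ _))]
  simp

theorem symbolPartial_mul {A b : MultiSpace n → ℂ} (hA : ContDiff ℝ ∞ A) (hb : ContDiff ℝ ∞ b)
    {r s : ℕ} (J : Fin r → Σ i : Fin d, Fin (n i)) (K : Fin s → Σ i : Fin d, Fin (n i))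
    (x ξ : MultiSpace n) :
    symbolPartial (fun x ξ => A x * b ξ) J K x ξ =
      iteratedFDeriv ℝ s A x (fun k => unitVec n (K k)) *
        iteratedFDeriv ℝ r b ξ (fun j => unitVec n (J j)) := by
  have h1 : ∀ ξ', iteratedFDeriv ℝ s (fun x' => A x' * b ξ') x (fun k => unitVec n (K k)) =
      iteratedFDeriv ℝ s A x (fun k => unitVec n (K k)) • b ξ' := by
    intro ξ'
    have : (fun x' => A x' * b ξ') = fun x' => b ξ' • A x' := by
      funext x'
      rw [smul_eq_mul, mul_comm]
    rw [this, iteratedFDeriv_const_smul_apply' (hA.contDiffAt.of_le (by exact_mod_cast le_top)),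
      smul_apply, smul_eq_mul, smul_eq_mul, mul_comm]
  unfold symbolPartial
  simp only [h1]
  rw [iteratedFDeriv_const_smul_apply' (hb.contDiffAt.of_le (by exact_mod_cast le_top))]
  rfl

/-- Since `|ξ_i| ≤ |ξ|` for each block, an isotropic symbol estimate implies the product one. -/
theorem isProductSymbol_mul_smoothRpow {m : ℝ} (hm : m ≤ 0) {A : MultiSpace n → ℂ}
    (hA : ContDiff ℝ ∞ A) (hAc : HasCompactSupport A) :
    IsProductSymbol m (fun x ξ => A x * smoothRpow (MultiSpace n) m ξ) where
  smooth := (hA.comp contDiff_fst).mul ((contDiff_smoothRpow m).comp contDiff_snd)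
  bound r s J K := by
    obtain ⟨C, hC, hb⟩ := exists_norm_iteratedFDeriv_smoothRpow_le (V := MultiSpace n) hm r
    have hc : Continuous (iteratedFDeriv ℝ s A) :=
      hA.continuous_iteratedFDeriv (by exact_mod_cast le_top)
    obtain ⟨D, hD⟩ := hc.bounded_above_of_compact_support (hAc.iteratedFDeriv (𝕜 := ℝ) s)
    have hD0 : 0 ≤ D := (norm_nonneg _).trans (hD 0)
    refine ⟨D * C, fun x ξ => ?_⟩
    rw [symbolPartial_mul hA (contDiff_smoothRpow m), norm_mul]
    have h1 : ‖iteratedFDeriv ℝ s A x (fun k => unitVec n (K k))‖ ≤ D := by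
      refine (ContinuousMultilinearMap.le_opNorm _ _).trans ?_
      simpa [norm_unitVec] using hD x
    have h2 : ‖iteratedFDeriv ℝ r (smoothRpow (MultiSpace n) m) ξ (fun j => unitVec n (J j))‖ ≤
        C * (1 + ‖ξ‖) ^ (m - r) := by
      refine (ContinuousMultilinearMap.le_opNorm _ _).trans ?_
      simpa [norm_unitVec] using hb ξ
    have h3 : (1 + ‖ξ‖) ^ (m - r) ≤
        (1 + ‖ξ‖) ^ m * ∏ i, ((1 + ‖ξ i‖) ^ blockOrder J i)⁻¹ := by
      rw [Real.rpow_sub (by positivity), div_eq_mul_inv, Real.rpow_natCast]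
      refine mul_le_mul_of_nonneg_left ?_ (by positivity)
      rw [Finset.prod_inv_distrib]
      refine inv_anti₀ (Finset.prod_pos fun i _ => by positivity) ?_
      calc ∏ i, (1 + ‖ξ i‖) ^ blockOrder J i ≤ ∏ i, (1 + ‖ξ‖) ^ blockOrder J i := by
            refine Finset.prod_le_prod (fun i _ => by positivity) fun i _ => ?_
            gcongr
            exact PiLp.norm_apply_le ξ i
        _ = (1 + ‖ξ‖) ^ r := by rw [Finset.prod_pow_eq_pow_sum, sum_blockOrder]
    calc _ ≤ D * (C * (1 + ‖ξ‖) ^ (m - r)) := by gcongr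
      _ ≤ D * (C * ((1 + ‖ξ‖) ^ m * ∏ i, ((1 + ‖ξ i‖) ^ blockOrder J i)⁻¹)) := by gcongr
      _ = _ := by ring

end ProductSymbol

/-! ### The operator and interpolation inequalities -/

section Operator

variable {d : ℕ} {n : Fin d → ℕ}

theorem sumPhase_wavePhase (x ξ : MultiSpace n) :
    sumPhase (fun _ => wavePhase) x ξ = inner ℝ x ξ + blockNormSum ξ := by
  simp only [sumPhase, wavePhase, Finset.sum_add_distrib, blockNormSum, PiLp.inner_apply]

/-- The action of the operator with symbol `A(x) b(ξ)`: on the Fourier side it multiplies by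
`e^{2π i ∑ |ξ_i|} b(ξ)`, and then it multiplies by `A`. -/
theorem fourierIntegralOp_fourierInv {A b : MultiSpace n → ℂ} {W U : 𝓢(MultiSpace n, ℂ)}
    (h : ∀ ξ, Complex.exp (2 * Real.pi * Complex.I * blockNormSum ξ) * b ξ * W ξ = U ξ) :
    fourierIntegralOp (sumPhase fun _ => wavePhase) (fun x ξ => A x * b ξ) (𝓕⁻ W) =
      fun x => A x * (𝓕⁻ U) x := by
  funext x
  have hW : 𝓕 ((𝓕⁻ W : 𝓢(MultiSpace n, ℂ)) : MultiSpace n → ℂ) = W := by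
    rw [← SchwartzMap.fourier_coe, FourierTransform.fourier_fourierInv_eq]
  rw [fourierIntegralOp, hW, fourierInv_schwartz_apply, ← integral_const_mul]
  refine integral_congr_ae (Filter.Eventually.of_forall fun ξ => ?_)
  simp only [sumPhase_wavePhase, ← h ξ, Complex.ofReal_add, mul_add, Complex.exp_add]
  ring

theorem norm_cutoff_mul_le {V : Type*} {a : V → ℝ} (h0 : ∀ x, 0 ≤ a x)
    (h1 : ∀ x, a x ≤ 1) (u : V → ℂ) (x : V) :
    ‖(a x : ℂ) * u x‖ ≤ ‖u x‖ := by
  rw [norm_mul, Complex.norm_real, Real.norm_of_nonneg (h0 x)]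
  exact mul_le_of_le_one_left (norm_nonneg _) (h1 x)

variable {V : Type*} [NormedAddCommGroup V] [InnerProductSpace ℝ V] [FiniteDimensional ℝ V]
  [MeasurableSpace V] [BorelSpace V]

theorem memLp_cutoff_mul {a : V → ℝ} (hc : Continuous a) (h0 : ∀ x, 0 ≤ a x) (h1 : ∀ x, a x ≤ 1)
    (u : 𝓢(V, ℂ)) (p : ℝ≥0∞) : MemLp (fun x => (a x : ℂ) * u x) p := by
  refine (u.memLp p).mono ?_ (Filter.Eventually.of_forall fun x => norm_cutoff_mul_le h0 h1 u x)
  exact ((Complex.continuous_ofReal.comp hc).mul u.continuous).aestronglyMeasurable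

theorem integrable_norm_rpow_of_memLp {f : V → ℂ} {p : ℝ} (hp : 0 < p)
    (hf : MemLp f (ENNReal.ofReal p)) : Integrable (fun x => ‖f x‖ ^ p) := by
  have := hf.integrable_norm_rpow (by simpa using hp) ENNReal.ofReal_ne_top
  rwa [ENNReal.toReal_ofReal hp.le] at this

/-- The `L^p` bound in terms of integrals, for the functions at hand, which are all in `L^p`. -/
theorem IsBoundedOnLp.exists_integral_le {p : ℝ} (hp : 1 < p)
    {T : 𝓢(MultiSpace n, ℂ) → MultiSpace n → ℂ} (hT : IsBoundedOnLp (ENNReal.ofReal p) T)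
    {a : MultiSpace n → ℝ} (hc : Continuous a) (h0 : ∀ x, 0 ≤ a x) (h1 : ∀ x, a x ≤ 1) :
    ∃ C : ℝ, 0 ≤ C ∧ ∀ f u : 𝓢(MultiSpace n, ℂ), T f = (fun x => (a x : ℂ) * u x) →
      ∫ x, ‖(a x : ℂ) * u x‖ ^ p ≤ C * ∫ x, ‖f x‖ ^ p := by
  obtain ⟨C, hC⟩ := hT
  have hp0 : 0 < p := by linarith
  refine ⟨(C : ℝ) ^ p, by positivity, fun f u hfu => ?_⟩
  have h := hC f
  have hpne : ENNReal.ofReal p ≠ 0 := by simpa using hp0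
  rw [hfu, (memLp_cutoff_mul hc h0 h1 u _).eLpNorm_eq_integral_rpow_norm hpne
    ENNReal.ofReal_ne_top, (f.memLp _ volume).eLpNorm_eq_integral_rpow_norm hpne
    ENNReal.ofReal_ne_top,
    ENNReal.toReal_ofReal hp0.le, ← ENNReal.ofReal_coe_nnreal,
    ← ENNReal.ofReal_mul C.coe_nonneg] at h
  have hX : 0 ≤ ∫ x, ‖(a x : ℂ) * u x‖ ^ p := integral_nonneg fun x => by positivity
  have hY : 0 ≤ ∫ x, ‖f x‖ ^ p := integral_nonneg fun x => by positivity
  have h' := (ENNReal.ofReal_le_ofReal_iff (by positivity)).1 h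
  have h'' := Real.rpow_le_rpow (by positivity) h' hp0.le
  rwa [Real.mul_rpow C.coe_nonneg (by positivity), Real.rpow_inv_rpow hX hp0.ne',
    Real.rpow_inv_rpow hY hp0.ne'] at h''

theorem not_forall_rpow_le {α β k K : ℝ} (hαβ : β < α) (hk : 0 < k)
    (h : ∀ l : ℝ, 1 ≤ l → k * l ^ α ≤ K * l ^ β) : False := by
  have ht := (tendsto_rpow_atTop (sub_pos.2 hαβ)).eventually_gt_atTop (K / k)
  obtain ⟨l, hl1, hl2⟩ := (ht.and (Filter.eventually_ge_atTop 1)).exists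
  have hl0 : 0 < l := by linarith
  have h3 := h l hl2
  have hpos : 0 < l ^ β := Real.rpow_pos_of_pos hl0 _
  rw [Real.rpow_sub hl0, div_lt_div_iff₀ hk hpos] at hl1
  linarith

/-- Interpolation between `L^2` and `L^∞` for `p ≥ 2`. -/
theorem integral_norm_rpow_le_of_bound {f : V → ℂ} {p M : ℝ} (hp : 2 ≤ p)
    (hfp : MemLp f (ENNReal.ofReal p)) (hf2 : MemLp f 2) (hM : ∀ x, ‖f x‖ ≤ M) :
    ∫ x, ‖f x‖ ^ p ≤ M ^ (p - 2) * ∫ x, ‖f x‖ ^ 2 := by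
  rw [← integral_const_mul]
  refine integral_mono (integrable_norm_rpow_of_memLp (by linarith) hfp)
    (((memLp_two_iff_integrable_sq_norm hf2.aestronglyMeasurable).1 hf2).const_mul _) fun x => ?_
  rcases (norm_nonneg (f x)).eq_or_lt with h0 | h0
  · simp only [← h0]
    rw [Real.zero_rpow (by linarith)]
    simp
  · have : ‖f x‖ ^ p = ‖f x‖ ^ (p - 2) * ‖f x‖ ^ 2 := by
      rw [← Real.rpow_natCast, ← Real.rpow_add h0]
      congr 1
      push_cast
      ring
    simp only [this]
    gcongr
    · exact hM x

/-- Interpolation between `L^p` and `L^∞` for `p ≤ 2`. -/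
theorem integral_norm_sq_le_of_bound {f : V → ℂ} {p M : ℝ} (hp0 : 0 < p) (hp : p ≤ 2)
    (hfp : MemLp f (ENNReal.ofReal p)) (hf2 : MemLp f 2) (hM : ∀ x, ‖f x‖ ≤ M) :
    ∫ x, ‖f x‖ ^ 2 ≤ M ^ (2 - p) * ∫ x, ‖f x‖ ^ p := by
  rw [← integral_const_mul]
  refine integral_mono ((memLp_two_iff_integrable_sq_norm hf2.aestronglyMeasurable).1 hf2)
    ((integrable_norm_rpow_of_memLp hp0 hfp).const_mul _) fun x => ?_
  rcases (norm_nonneg (f x)).eq_or_lt with h0 | h0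
  · simp only [← h0]
    rw [Real.zero_rpow hp0.ne']
    simp
  · have : ‖f x‖ ^ 2 = ‖f x‖ ^ (2 - p) * ‖f x‖ ^ p := by
      rw [← Real.rpow_natCast, ← Real.rpow_add h0]
      congr 1
      push_cast
      ring
    simp only [this]
    gcongr
    exact hM x

end Operator

/-! ### Failure of boundedness -/

section Counterexamples

variable {d : ℕ} {n : Fin d → ℕ} {χ : MultiSpace n → ℝ}

theorem blockNormSum_smul {l : ℝ} (hl : 0 ≤ l) (ξ : MultiSpace n) :
    blockNormSum (l • ξ) = l * blockNormSum ξ := by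
  simp [blockNormSum, norm_smul, Finset.mul_sum, abs_of_nonneg hl]

theorem integral_norm_rpow_mul_fourierInv_schwartzDilation {l : ℝ} (hl : 0 < l)
    (f : 𝓢(MultiSpace n, ℂ)) (a : MultiSpace n → ℝ) (p : ℝ) :
    ∫ x, ‖(a x : ℂ) * (𝓕⁻ (schwartzDilation l hl.ne' f)) x‖ ^ p =
      l ^ (totalDim n * p - totalDim n) * ∫ x, ‖(a (l⁻¹ • x) : ℂ) * (𝓕⁻ f) x‖ ^ p := by
  have h := Measure.integral_comp_smul_of_nonneg (volume : Measure (MultiSpace n))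
    (fun x => ‖(a (l⁻¹ • x) : ℂ) * (𝓕⁻ f) x‖ ^ p) l (hR := hl.le)
  rw [pow_finrank_multiSpace, smul_eq_mul] at h
  rw [Real.rpow_sub hl, Real.rpow_mul hl.le, div_mul_eq_mul_div, mul_div_assoc, div_eq_inv_mul, ← h,
    ← integral_const_mul]
  refine integral_congr_ae (Filter.Eventually.of_forall fun x => ?_)
  have hN : 0 < l ^ totalDim n := Real.rpow_pos_of_pos hl _
  have hx := fourierInv_schwartzDilation hl f x
  rw [pow_finrank_multiSpace] at hx
  simp only [hx, inv_smul_smul₀ hl.ne']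
  rw [mul_left_comm, norm_mul, Real.mul_rpow (norm_nonneg _) (norm_nonneg _), Complex.norm_real,
    Real.norm_of_nonneg hN.le]

theorem integral_norm_rpow_mul_fourierInv_smul {c : ℝ} (hc : 0 ≤ c)
    (f : 𝓢(MultiSpace n, ℂ)) (a : MultiSpace n → ℝ) (p : ℝ) :
    ∫ x, ‖(a x : ℂ) * (𝓕⁻ ((c : ℂ) • f)) x‖ ^ p = c ^ p * ∫ x, ‖(a x : ℂ) * (𝓕⁻ f) x‖ ^ p := by
  rw [← integral_const_mul]
  refine integral_congr_ae (Filter.Eventually.of_forall fun x => ?_)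
  simp only [FourierTransform.fourierInv_smul, smul_apply, smul_eq_mul]
  rw [mul_left_comm, norm_mul, Real.mul_rpow (norm_nonneg _) (norm_nonneg _), Complex.norm_real,
    Real.norm_of_nonneg hc]

namespace IsBlockBump

/-- At time `1` a fixed proportion of the `L^2` mass of the half-waves remains in a fixed ball,
uniformly in the frequency. -/
theorem exists_le_integral_cutoff_halfWave (hχ : IsBlockBump χ) :
    ∃ R : ℝ, 1 ≤ R ∧ ∀ a : ContDiffBump (0 : MultiSpace n), R ≤ a.rIn →
      ∀ (l : ℝ) (hl0 : 0 < l), 1 ≤ l →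
        (∫ ξ, χ ξ ^ 2) / 2 * l ^ totalDim n ≤
          ∫ x, ‖(a x : ℂ) * (𝓕⁻ (schwartzDilation l hl0.ne' (hχ.halfWave (1 * l)))) x‖ ^ 2 := by
  set E := ∫ ξ, χ ξ ^ 2 with hE
  have hEpos : 0 < E := hχ.integral_sq_pos
  set D := Module.finrank ℝ (MultiSpace n) * ∫ ξ, gradBound χ ξ ^ 2 with hD
  have hD0 : 0 ≤ D := mul_nonneg (Nat.cast_nonneg _) (integral_nonneg fun ξ => sq_nonneg _)
  -- with this radius, Chebyshev's inequality loses at most half of the mass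
  refine ⟨1 + √(2 * D / E), by linarith [Real.sqrt_nonneg (2 * D / E)], fun a ha l hl0 hl => ?_⟩
  have hR0 : 0 < a.rIn := a.rIn_pos
  have hR : 2 * D / E ≤ a.rIn ^ 2 := by
    have h1 : √(2 * D / E) ≤ a.rIn := by linarith
    have h2 := Real.sq_sqrt (by positivity : 0 ≤ 2 * D / E)
    have h3 := Real.sqrt_nonneg (2 * D / E)
    nlinarith
  set f := hχ.halfWave (1 * l)
  set g := 𝓕⁻ (schwartzDilation l hl0.ne' f) with hg
  have hgrad : ∀ ξ, ‖fderiv ℝ f ξ‖ ≤ 2 * l * gradBound χ ξ := by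
    intro ξ
    refine (hχ.norm_fderiv_halfWave_le _ ξ).trans ?_
    refine mul_le_mul_of_nonneg_right ?_ (gradBound_nonneg ξ)
    rw [one_mul, abs_of_pos hl0]
    linarith
  obtain ⟨hint, hmom⟩ := integral_norm_sq_mul_fourierInv_schwartzDilation_le hl0 f
    hχ.integrable_sq_gradBound hgrad
  have hmass : ∫ x, ‖g x‖ ^ 2 = l ^ totalDim n * E := by
    rw [hg, integral_norm_sq_fourierInv_schwartzDilation hl0, pow_finrank_multiSpace]
    simp only [f, norm_halfWave, hE]
  have hpt : ∀ x, ‖g x‖ ^ 2 - (a.rIn ^ 2)⁻¹ * (‖x‖ ^ 2 * ‖g x‖ ^ 2) ≤ ‖(a x : ℂ) * g x‖ ^ 2 := by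
    intro x
    rcases le_total ‖x‖ a.rIn with hx | hx
    · rw [a.one_of_mem_closedBall (by simpa using hx)]
      simp only [Complex.ofReal_one, one_mul, sub_le_self_iff]
      positivity
    · have h1 : 1 ≤ (a.rIn ^ 2)⁻¹ * ‖x‖ ^ 2 := by
        rw [inv_mul_eq_div, one_le_div (by positivity)]
        gcongr
      have h2 : 0 ≤ ‖g x‖ ^ 2 := by positivity
      have h3 : 0 ≤ ‖(a x : ℂ) * g x‖ ^ 2 := by positivity
      nlinarith
  have hag : Integrable fun x => ‖(a x : ℂ) * g x‖ ^ 2 := by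
    have h := memLp_cutoff_mul a.continuous (fun x => a.nonneg) (fun x => a.le_one) g 2
    exact (memLp_two_iff_integrable_sq_norm h.aestronglyMeasurable).1 h
  have hle := integral_mono ((integrable_norm_sq_schwartz g).sub (hint.const_mul _)) hag hpt
  rw [integral_sub' (integrable_norm_sq_schwartz g) (hint.const_mul _), integral_const_mul,
    hmass] at hle
  rw [pow_finrank_multiSpace, ← hD] at hmom
  refine le_trans ?_ hle
  have hN : 0 < l ^ totalDim n := Real.rpow_pos_of_pos hl0 _
  have h4 : (a.rIn ^ 2)⁻¹ * ∫ x, ‖x‖ ^ 2 * ‖g x‖ ^ 2 ≤ (a.rIn ^ 2)⁻¹ * (l ^ totalDim n * D) := by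
    gcongr
  have h5 : (a.rIn ^ 2)⁻¹ * D ≤ E / 2 := by
    rw [inv_mul_le_iff₀ (by positivity)]
    rw [div_le_iff₀ hEpos] at hR
    linarith
  nlinarith

variable [Nonempty (Fin d)]

theorem smoothRpow_mul_dilated (hχ : IsBlockBump χ) (m : ℝ) {l : ℝ} (hl : 1 ≤ l)
    (ξ : MultiSpace n) :
    smoothRpow (MultiSpace n) m ξ * χ (l⁻¹ • ξ) =
      ((l ^ m : ℝ) : ℂ) * (((‖l⁻¹ • ξ‖ ^ m : ℝ) : ℂ) * χ (l⁻¹ • ξ)) := by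
  have hl0 : 0 < l := by linarith
  by_cases h : χ (l⁻¹ • ξ) = 0
  · simp [h]
  · have h1 := hχ.one_le_norm' (mem_tsupport h)
    have h2 : ‖ξ‖ = l * ‖l⁻¹ • ξ‖ := by
      rw [norm_smul, norm_inv, Real.norm_of_nonneg hl0.le, mul_inv_cancel_left₀ hl0.ne']
    rw [smoothRpow_of_one_le m (by rw [h2]; nlinarith), h2, Real.mul_rpow hl0.le (norm_nonneg _),
      Complex.ofReal_mul, mul_assoc]

/-- The focusing wave: the operator undoes the half-wave and leaves a bump at scale `1 / l`. -/
theorem fourierIntegralOp_focusing (hχ : IsBlockBump χ) (m : ℝ) {l : ℝ} (hl0 : 0 < l) (hl : 1 ≤ l)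
    (A : MultiSpace n → ℂ) :
    fourierIntegralOp (sumPhase fun _ => wavePhase)
      (fun x ξ => A x * smoothRpow (MultiSpace n) m ξ)
      (𝓕⁻ (schwartzDilation l hl0.ne' (hχ.halfWave (-1 * l)))) =
      fun x => A x *
        (𝓕⁻ (((l ^ m : ℝ) : ℂ) • schwartzDilation l hl0.ne' (hχ.rieszBump m))) x := by
  refine fourierIntegralOp_fourierInv fun ξ => ?_
  simp only [smul_apply, smul_eq_mul, schwartzDilation_apply, halfWave_apply,
    rieszBump_apply, blockNormSum_smul (inv_nonneg.2 hl0.le)]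
  rw [← hχ.smoothRpow_mul_dilated m hl ξ]
  have hl' : (l : ℂ) ≠ 0 := by exact_mod_cast hl0.ne'
  have he : Complex.exp (2 * Real.pi * Complex.I * blockNormSum ξ) *
      Complex.exp (2 * Real.pi * Complex.I * (-1 * l : ℝ) * (l⁻¹ * blockNormSum ξ : ℝ)) = 1 := by
    rw [← Complex.exp_add, ← Complex.exp_zero]
    congr 1
    push_cast
    field_simp
    ring
  linear_combination (smoothRpow (MultiSpace n) m ξ * χ (l⁻¹ • ξ)) * he

/-- The spreading wave: a bump at scale `1 / l` is sent to a half-wave. -/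
theorem fourierIntegralOp_spreading (hχ : IsBlockBump χ) (m : ℝ) {l : ℝ} (hl0 : 0 < l) (hl : 1 ≤ l)
    (A : MultiSpace n → ℂ) :
    fourierIntegralOp (sumPhase fun _ => wavePhase)
      (fun x ξ => A x * smoothRpow (MultiSpace n) m ξ)
      (𝓕⁻ (schwartzDilation l hl0.ne' (hχ.rieszBump (-m)))) =
      fun x => A x *
        (𝓕⁻ (((l ^ m : ℝ) : ℂ) • schwartzDilation l hl0.ne' (hχ.halfWave (1 * l)))) x := by
  refine fourierIntegralOp_fourierInv fun ξ => ?_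
  simp only [smul_apply, smul_eq_mul, schwartzDilation_apply, halfWave_apply,
    rieszBump_apply, blockNormSum_smul (inv_nonneg.2 hl0.le)]
  have hl' : (l : ℂ) ≠ 0 := by exact_mod_cast hl0.ne'
  have he : (2 * Real.pi * Complex.I * (1 * l : ℝ) * (l⁻¹ * blockNormSum ξ : ℝ) : ℂ) =
      2 * Real.pi * Complex.I * blockNormSum ξ := by
    push_cast
    field_simp
  rw [he]
  by_cases h : χ (l⁻¹ • ξ) = 0
  · simp [h]
  have h0 : 0 < ‖l⁻¹ • ξ‖ := by linarith [hχ.one_le_norm' (mem_tsupport h)]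
  have hm : ((‖l⁻¹ • ξ‖ ^ m : ℝ) : ℂ) * ((‖l⁻¹ • ξ‖ ^ (-m) : ℝ) : ℂ) = 1 := by
    rw [← Complex.ofReal_mul, ← Real.rpow_add h0]
    simp
  linear_combination (Complex.exp (2 * Real.pi * Complex.I * blockNormSum ξ) *
    ((‖l⁻¹ • ξ‖ ^ (-m) : ℝ) : ℂ)) * hχ.smoothRpow_mul_dilated m hl ξ +
    (Complex.exp (2 * Real.pi * Complex.I * blockNormSum ξ) * ((l ^ m : ℝ) : ℂ) *
      χ (l⁻¹ • ξ)) * hm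

theorem fourierInv_rieszBump_zero_ne_zero (hχ : IsBlockBump χ) (m : ℝ) :
    (𝓕⁻ (hχ.rieszBump m)) 0 ≠ 0 := by
  have h : (𝓕⁻ (hχ.rieszBump m)) 0 = ((∫ ξ, ‖hχ.rieszBump m ξ‖ : ℝ) : ℂ) := by
    rw [fourierInv_schwartz_apply, ← integral_complex_ofReal]
    refine integral_congr_ae (Filter.Eventually.of_forall fun ξ => ?_)
    have h1 : 0 ≤ ‖ξ‖ ^ m := by positivity
    simp [rieszBump_apply, abs_of_nonneg h1, abs_of_nonneg (hχ.nonneg ξ)]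
  rw [h]
  obtain ⟨ξ, hξ⟩ := hχ.exists_pos
  have h0 : 0 < ‖ξ‖ := by linarith [hχ.one_le_norm' (mem_tsupport hξ.ne')]
  have hpos : 0 < ∫ ξ, ‖hχ.rieszBump m ξ‖ := by
    refine integral_pos_of_integrable_nonneg_nonzero (x := ξ) (hχ.rieszBump m).continuous.norm
      (hχ.rieszBump m).integrable.norm (fun ξ => norm_nonneg _) ?_
    have h1 : ‖ξ‖ ^ m ≠ 0 := (Real.rpow_pos_of_pos h0 m).ne'
    rw [rieszBump_apply, norm_ne_zero_iff]
    exact mul_ne_zero (by exact_mod_cast h1) (by exact_mod_cast hξ.ne')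
  exact_mod_cast hpos.ne'

/-- Failure of boundedness for `p > 2`, by the focusing wave. -/
theorem not_isBoundedOnLp_of_two_lt (hχ : IsBlockBump χ) (hn : ∀ i, 1 ≤ n i)
    (a : ContDiffBump (0 : MultiSpace n)) (ha : 1 ≤ a.rIn) {m p : ℝ} (hp : 2 < p)
    (hmp : -(totalDim n - d) * (1 / 2 - 1 / p) < m) :
    ¬ IsBoundedOnLp (ENNReal.ofReal p) (fourierIntegralOp (sumPhase fun _ => wavePhase)
      (fun x ξ => (a x : ℂ) * smoothRpow (MultiSpace n) m ξ)) := by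
  intro hT
  obtain ⟨C, hC, hbd⟩ := hT.exists_integral_le (by linarith) a.continuous (fun x => a.nonneg)
    fun x => a.le_one
  obtain ⟨M, hM, hsup⟩ := hχ.exists_norm_fourierInv_halfWave_le hn
  have hp0 : 0 < p := by linarith
  set H := 𝓕⁻ (hχ.rieszBump m) with hH
  set κ := ∫ x in Metric.ball (0 : MultiSpace n) 1, ‖H x‖ ^ p with hκ
  have hHint : Integrable (fun x => ‖H x‖ ^ p) := integrable_norm_rpow_of_memLp hp0 (H.memLp _)
  have hκpos : 0 < κ := by
    rw [hκ, setIntegral_pos_iff_support_of_nonneg_ae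
      (Filter.Eventually.of_forall fun x => by positivity) hHint.integrableOn]
    have hc : Continuous fun x => ‖H x‖ ^ p := H.continuous.norm.rpow_const fun x => Or.inr hp0.le
    refine (hc.isOpen_support.inter Metric.isOpen_ball).measure_pos _ ⟨0, ?_, by simp⟩
    have := norm_pos_iff.2 (hχ.fourierInv_rieszBump_zero_ne_zero m)
    exact (Real.rpow_pos_of_pos this p).ne'
  set E := ∫ ξ, χ ξ ^ 2 with hE
  refine not_forall_rpow_le (α := m * p + (totalDim n * p - totalDim n))
    (β := (totalDim n + d) / 2 * (p - 2) + totalDim n) (k := κ) (K := C * (M ^ (p - 2) * E))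
    ?_ hκpos fun l hl => ?_
  · have h1 : -(totalDim n - d) * (1 / 2 - 1 / p) * p < m * p := mul_lt_mul_of_pos_right hmp hp0
    have h2 : -(totalDim n - d) * (1 / 2 - 1 / p) * p = -(totalDim n - d) * (p / 2 - 1) := by
      field_simp
    rw [h2] at h1
    linarith
  have hl0 : 0 < l := by linarith
  have hmain := hbd _ _ (hχ.fourierIntegralOp_focusing m hl0 hl fun x => (a x : ℂ))
  rw [integral_norm_rpow_mul_fourierInv_smul (by positivity),
    integral_norm_rpow_mul_fourierInv_schwartzDilation hl0] at hmain
  have hlow : κ ≤ ∫ x, ‖(a (l⁻¹ • x) : ℂ) * H x‖ ^ p := by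
    have hcont : Continuous fun x => a (l⁻¹ • x) := a.continuous.comp (by fun_prop)
    have hint : Integrable fun x => ‖(a (l⁻¹ • x) : ℂ) * H x‖ ^ p :=
      integrable_norm_rpow_of_memLp hp0
        (memLp_cutoff_mul hcont (fun x => a.nonneg) (fun x => a.le_one) H _)
    rw [hκ]
    refine le_of_eq_of_le ?_ (setIntegral_le_integral (s := Metric.ball (0 : MultiSpace n) 1) hint
      (Filter.Eventually.of_forall fun x => by positivity))
    refine setIntegral_congr_fun Metric.isOpen_ball.measurableSet fun x hx => ?_
    have hx1 : ‖x‖ < 1 := by simpa using hx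
    have : a (l⁻¹ • x) = 1 := by
      refine a.one_of_mem_closedBall ?_
      rw [mem_closedBall_zero_iff, norm_smul, norm_inv, Real.norm_of_nonneg hl0.le]
      calc l⁻¹ * ‖x‖ ≤ 1 * 1 := by
            gcongr
            exact inv_le_one_of_one_le₀ hl
        _ ≤ a.rIn := by linarith
    simp [this]
  set g := 𝓕⁻ (schwartzDilation l hl0.ne' (hχ.halfWave (-1 * l))) with hg
  have hup : ∫ x, ‖g x‖ ^ p ≤
      (M * l ^ ((totalDim n + d) / 2)) ^ (p - 2) * (l ^ totalDim n * E) := by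
    have h := integral_norm_rpow_le_of_bound hp.le (g.memLp _) (g.memLp 2)
      (hsup (-1) (by simp) l hl0)
    rw [integral_norm_sq_fourierInv_schwartzDilation hl0, pow_finrank_multiSpace] at h
    simpa only [norm_halfWave] using h
  calc κ * l ^ (m * p + (totalDim n * p - totalDim n))
      = (l ^ m) ^ p * (l ^ (totalDim n * p - totalDim n) * κ) := by
        rw [Real.rpow_add hl0, Real.rpow_mul hl0.le]
        ring
    _ ≤ (l ^ m) ^ p * (l ^ (totalDim n * p - totalDim n) *
          ∫ x, ‖(a (l⁻¹ • x) : ℂ) * H x‖ ^ p) := by gcongr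
    _ ≤ C * ∫ x, ‖g x‖ ^ p := hmain
    _ ≤ C * ((M * l ^ ((totalDim n + d) / 2)) ^ (p - 2) * (l ^ totalDim n * E)) := by gcongr
    _ = C * (M ^ (p - 2) * E) * l ^ ((totalDim n + d) / 2 * (p - 2) + totalDim n) := by
        rw [Real.rpow_add hl0, Real.rpow_mul hl0.le, Real.mul_rpow hM (by positivity)]
        ring

/-- Failure of boundedness for `p < 2`, by the spreading wave. -/
theorem not_isBoundedOnLp_of_lt_two (hχ : IsBlockBump χ) (hn : ∀ i, 1 ≤ n i)
    (a : ContDiffBump (0 : MultiSpace n))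
    (ha : ∀ (l : ℝ) (hl0 : 0 < l), 1 ≤ l →
        (∫ ξ, χ ξ ^ 2) / 2 * l ^ totalDim n ≤
          ∫ x, ‖(a x : ℂ) * (𝓕⁻ (schwartzDilation l hl0.ne' (hχ.halfWave (1 * l)))) x‖ ^ 2)
    {m p : ℝ} (hp1 : 1 < p) (hp : p < 2)
    (hmp : -(totalDim n - d) * (1 / p - 1 / 2) < m) :
    ¬ IsBoundedOnLp (ENNReal.ofReal p) (fourierIntegralOp (sumPhase fun _ => wavePhase)
      (fun x ξ => (a x : ℂ) * smoothRpow (MultiSpace n) m ξ)) := by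
  intro hT
  obtain ⟨C, hC, hbd⟩ := hT.exists_integral_le hp1 a.continuous (fun x => a.nonneg)
    fun x => a.le_one
  obtain ⟨M, hM, hsup⟩ := hχ.exists_norm_fourierInv_halfWave_le hn
  have hp0 : 0 < p := by linarith
  set F := 𝓕⁻ (hχ.rieszBump (-m)) with hF
  set J := ∫ x, ‖F x‖ ^ p with hJ
  set E := ∫ ξ, χ ξ ^ 2 with hE
  have hEpos : 0 < E := hχ.integral_sq_pos
  refine not_forall_rpow_le (α := m * p + totalDim n)
    (β := (totalDim n + d) / 2 * (2 - p) + (totalDim n * p - totalDim n)) (k := E / 2)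
    (K := M ^ (2 - p) * (C * J)) ?_ (by linarith) fun l hl => ?_
  · have h1 : -(totalDim n - d) * (1 / p - 1 / 2) * p < m * p := mul_lt_mul_of_pos_right hmp hp0
    have h2 : -(totalDim n - d) * (1 / p - 1 / 2) * p = -(totalDim n - d) * (1 - p / 2) := by
      field_simp
    rw [h2] at h1
    linarith
  have hl0 : 0 < l := by linarith
  have hmain := hbd _ _ (hχ.fourierIntegralOp_spreading m hl0 hl fun x => (a x : ℂ))
  rw [integral_norm_rpow_mul_fourierInv_smul (by positivity)] at hmain
  have hf := integral_norm_rpow_mul_fourierInv_schwartzDilation hl0 (hχ.rieszBump (-m))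
    (fun _ => 1) p
  simp only [Complex.ofReal_one, one_mul] at hf
  rw [hf] at hmain
  set g := 𝓕⁻ (schwartzDilation l hl0.ne' (hχ.halfWave (1 * l))) with hg
  have hag := fun q => memLp_cutoff_mul a.continuous (fun x => a.nonneg) (fun x => a.le_one) g q
  have hinterp := integral_norm_sq_le_of_bound hp0 hp.le (hag _) (hag 2) fun x =>
    (norm_cutoff_mul_le (fun x => a.nonneg) (fun x => a.le_one) g x).trans
      (hsup 1 (by simp) l hl0 x)
  calc E / 2 * l ^ (m * p + totalDim n) = (l ^ m) ^ p * (E / 2 * l ^ totalDim n) := by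
        rw [Real.rpow_add hl0, Real.rpow_mul hl0.le]
        ring
    _ ≤ (l ^ m) ^ p * ((M * l ^ ((totalDim n + d) / 2)) ^ (2 - p) *
          ∫ x, ‖(a x : ℂ) * g x‖ ^ p) :=
        mul_le_mul_of_nonneg_left ((ha l hl0 hl).trans hinterp) (by positivity)
    _ = (M * l ^ ((totalDim n + d) / 2)) ^ (2 - p) *
          ((l ^ m) ^ p * ∫ x, ‖(a x : ℂ) * g x‖ ^ p) := by ring
    _ ≤ (M * l ^ ((totalDim n + d) / 2)) ^ (2 - p) *
          (C * (l ^ (totalDim n * p - totalDim n) * J)) := by gcongr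
    _ = M ^ (2 - p) * (C * J) *
          l ^ ((totalDim n + d) / 2 * (2 - p) + (totalDim n * p - totalDim n)) := by
        rw [Real.rpow_add hl0, Real.rpow_mul hl0.le ((totalDim n + d) / 2),
          Real.mul_rpow hM (by positivity)]
        ring

end IsBlockBump

end Counterexamples

theorem mainTheorem2 (d : ℕ) (hd : 2 ≤ d) (n : Fin d → ℕ) (hn : ∀ i, 2 ≤ n i) (m : ℝ)
    (hm : -(((∑ i, n i : ℕ) : ℝ) - d) / 2 < m) (hm0 : m ≤ 0) :
    ∃ σ : MultiSpace n → MultiSpace n → ℂ,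
      IsProductSymbol m σ ∧ HasCompactSupportInX σ ∧
        ∀ p : ℝ, 1 < p → -(((∑ i, n i : ℕ) : ℝ) - d) * |1 / p - 1 / 2| < m →
          ¬ IsBoundedOnLp (ENNReal.ofReal p)
            (fourierIntegralOp (sumPhase fun _ => wavePhase) σ) := by
  have : Nonempty (Fin d) := ⟨⟨0, by omega⟩⟩
  have hn1 : ∀ i, 1 ≤ n i := fun i => by linarith [hn i]
  obtain ⟨χ, hχ⟩ := exists_isBlockBump hn1
  obtain ⟨R, hR, hmass⟩ := hχ.exists_le_integral_cutoff_halfWave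
  let a : ContDiffBump (0 : MultiSpace n) := ⟨R, R + 1, by linarith, by linarith⟩
  have hA : ContDiff ℝ ∞ fun x : MultiSpace n => (a x : ℂ) :=
    Complex.ofRealCLM.contDiff.comp a.contDiff
  have hAc : HasCompactSupport fun x : MultiSpace n => (a x : ℂ) :=
    a.hasCompactSupport.comp_left (g := fun t : ℝ => (t : ℂ)) Complex.ofReal_zero
  refine ⟨fun x ξ => (a x : ℂ) * smoothRpow (MultiSpace n) m ξ,
    isProductSymbol_mul_smoothRpow hm0 hA hAc, ⟨_, hAc, fun x hx ξ => ?_⟩, fun p hp hmp => ?_⟩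
  · simp only [image_eq_zero_of_notMem_tsupport hx, zero_mul]
  change -(totalDim n - d) * |1 / p - 1 / 2| < m at hmp
  have hp0 : 0 < p := by linarith
  rcases lt_trichotomy p 2 with h | h | h
  · have h1 : 1 / 2 < 1 / p := one_div_lt_one_div_of_lt hp0 h
    rw [abs_of_pos (by linarith)] at hmp
    exact hχ.not_isBoundedOnLp_of_lt_two hn1 a (hmass a le_rfl) hp h hmp
  · -- for `p = 2` the hypothesis on `m` reads `0 < m`
    subst h
    simp only [sub_self, abs_zero, mul_zero] at hmp
    linarith
  · have h1 : 1 / p < 1 / 2 := one_div_lt_one_div_of_lt (by norm_num) h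
    rw [abs_sub_comm, abs_of_pos (by linarith)] at hmp
    exact hχ.not_isBoundedOnLp_of_two_lt hn1 a hR h hmp
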